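/- **Conventions.** Let $\mathrm{Cat}_*$ be the 2-category whose objects are pairs $(\mathcal X,X)$ of a category $\mathcal X$ and an object $X\in\mathcal X$; whose 1-cells $(F,\varphi):(\mathcal X,X)\to(\mathcal Y,Y)$ are functors $F:\mathcal X\to\mathcal Y$ with a morphism $\varphi:FX\to Y$; and whose 2-cells $(F,\varphi)\Rightarrow(G,\psi)$ are natural transformations $\sigma:F\Rightarrow G$ with $\psi\circ\sigma_X=\varphi$. It is a symmetric monoidal 2-category under product. A monoid $A$ in a monoidal category $\mathcal C$ makes $(\mathcal C,A)$ a pseudomonoid in $\mathrm{Cat}_*$, and a commutative monoid $Z$ in a braided monoidal category $\mathcal Z$ makes $(\mathcal Z,Z)$ a braided pseudomonoid. For a pseudomonoid $M$ on an object $X$ of a symmetric monoidal 2-category $\mathcal M$ and an object $U$, a *centre piece* for $M$ with domain $U$ is an object of the descent category $\mathrm{CP}(U,M)$ of the Hochschild diagram $\mathcal M(U,X)\rightrightarrows\mathcal M(U\otimes X,X)\to\mathcal M(U\otimes X\otimes X,X)$: a 1-cell $p:U\to X$ with an invertible 2-cell $\gamma_{u,x}:p(u)\cdot x\cong x\cdot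 p(u)$ between the two 1-cells $U\otimes X\to X$ obtained from $p$ by multiplying on the right and on the left, satisfying the cocycle condition $\gamma_{u,xy}=(x\cdot\gamma_{u,y})\circ(\gamma_{u,x}\cdot y)$ (up to associativity) and the unit condition; morphisms are 2-cells $p\Rightarrow p'$ commuting with $\gamma$. A *monoidal centre* of $M$ is an object $Z$ with a centre piece $P$ with domain $Z$ such that for every $U$ the functor $\mathcal M(U,Z)\to\mathrm{CP}(U,M)$, $h\mapsto h^*P$, is an equivalence, together with the braided pseudomonoid structure on $Z$ for which the projection $Z\to X$ underlying $P$ is strong monoidal, its structure 2-cells are morphisms of centre pieces (with respect to the evident tensor product of centre pieces and the unit centre piece), and the braiding is given by $\gamma$. Let $\mathcal Z(\mathcal C)$ be the (Drinfeld) centre of a monoidal category $\mathcal C$: objects are pairs $(Z,u)$ of an object $Z$ of $\mathcal C$ and an invertible half-braiding $u_V:Z\otimes V\to V\otimes Z$. For a monoid $(A,\mu,\eta)$ in $\mathcal C$, consider the category whose objects are pairs of $(Z,u)\in\mathcal Z(\mathcal C)$ and a morphism $\zeta:Z\to A$ in $\mathcal C$ with $\mu\circ(\zeta\otimes 1)=\mu\circ(1\otimes\zeta)\circ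 u_A$, and whose morphisms are the morphisms of $\mathcal Z(\mathcal C)$ compatible with the maps to $A$. A terminal object $i:z(A)\to A$ of this category is called a *full centre* of $A$ (in the sense of Davydov). **Proposition.** Let $A$ be a monoid in a monoidal category $\mathcal C$ which has a full centre $i:z(A)\to A$. Then $z(A)$ carries a commutative monoid structure in the braided monoidal category $\mathcal Z(\mathcal C)$ for which $i$ is a monoid morphism in $\mathcal C$, and the monoidal centre of the pseudomonoid $(\mathcal C,A)$ in $\mathrm{Cat}_*$ exists and is given by the braided pseudomonoid $(\mathcal Z(\mathcal C),z(A))$. Its universal centre piece is the forgetful functor $\mathcal Z(\mathcal C)\to\mathcal C$ together with $i$, with $\gamma$ given by the half-braidings, $\gamma_{(Z,u),V}=u_V$, and with the identities as the strong monoidal structure of the projection. -/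

import Mathlib

open CategoryTheory

set_option linter.all false

universe w v u

/-- An object of `Cat_*`: a category together with a chosen object. -/
structure CatStar : Type (max (u + 1) (v + 1)) where
  carrier : Type u
  [cat : Category.{v} carrier]
  pt : carrier

namespace CatStar

attribute [instance] CatStar.cat

/-- A 1-cell `(F, φ) : (𝒳, X) ⟶ (𝒴, Y)`: a functor `F` and a morphism `φ : F X ⟶ Y`. -/
structure Hom (X Y : CatStar.{v, u}) where
  functor : X.carrier ⥤ Y.carrier
  map : functor.obj X.pt ⟶ Y.pt

instance : CategoryStruct CatStar.{v, u} where
  Hom X Y := Hom X Y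
  id X := { functor := 𝟭 X.carrier, map := 𝟙 X.pt }
  comp f g := { functor := f.functor ⋙ g.functor, map := g.functor.map f.map ≫ g.map }

@[simp] theorem id_functor (X : CatStar.{v, u}) : (𝟙 X : X ⟶ X).functor = 𝟭 X.carrier := rfl
@[simp] theorem id_map (X : CatStar.{v, u}) : (𝟙 X : X ⟶ X).map = 𝟙 X.pt := rfl
@[simp] theorem comp_functor {X Y Z : CatStar.{v, u}} (f : X ⟶ Y) (g : Y ⟶ Z) :
    (f ≫ g).functor = f.functor ⋙ g.functor := rfl
@[simp] theorem comp_map {X Y Z : CatStar.{v, u}} (f : X ⟶ Y) (g : Y ⟶ Z) :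
    (f ≫ g).map = g.functor.map f.map ≫ g.map := rfl

/-- A 2-cell `(F, φ) ⟶ (G, ψ)`: a natural transformation `σ : F ⟶ G` with `σ_X ≫ ψ = φ`. -/
@[ext]
structure Hom₂ {X Y : CatStar.{v, u}} (f g : X ⟶ Y) where
  nat : f.functor ⟶ g.functor
  w : nat.app X.pt ≫ g.map = f.map := by cat_disch

instance homCat (X Y : CatStar.{v, u}) : Category (X ⟶ Y) where
  Hom f g := Hom₂ f g
  id f := { nat := 𝟙 f.functor, w := by simp }
  comp η θ := { nat := η.nat ≫ θ.nat, w := by simp [η.w, θ.w] }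
  id_comp η := Hom₂.ext (Category.id_comp _)
  comp_id η := Hom₂.ext (Category.comp_id _)
  assoc η θ κ := Hom₂.ext (Category.assoc _ _ _)

theorem hom₂_ext {X Y : CatStar.{v, u}} {f g : X ⟶ Y} {η θ : f ⟶ g}
    (h : ∀ x, η.nat.app x = θ.nat.app x) : η = θ :=
  Hom₂.ext (NatTrans.ext (funext h))

@[simp] theorem id_nat {X Y : CatStar.{v, u}} (f : X ⟶ Y) :
    Hom₂.nat (𝟙 f) = 𝟙 f.functor := rfl
@[simp] theorem comp_nat {X Y : CatStar.{v, u}} {f g h : X ⟶ Y} (η : f ⟶ g) (θ : g ⟶ h) :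
    (η ≫ θ).nat = η.nat ≫ θ.nat := rfl

/-- An invertible 2-cell from a natural isomorphism compatible with the chosen objects. -/
@[simps]
def mkIso {X Y : CatStar.{v, u}} {f g : X ⟶ Y} (e : f.functor ≅ g.functor)
    (w : e.hom.app X.pt ≫ g.map = f.map) : f ≅ g where
  hom := { nat := e.hom, w := w }
  inv := { nat := e.inv, w := by rw [← w]; simp }
  hom_inv_id := by apply hom₂_ext; simp
  inv_hom_id := by apply hom₂_ext; simp

/-- `Cat_*` as a 2-category (a bicategory whose structural 2-cells are identities, see `strict`). -/
instance bicategory : Bicategory CatStar.{v, u} where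
  homCategory X Y := homCat X Y
  whiskerLeft f _ _ η :=
    { nat := Functor.whiskerLeft f.functor η.nat
      w := by simp [← η.w] }
  whiskerRight {_ _ _ f g} η h :=
    { nat := Functor.whiskerRight η.nat h.functor
      w := by
        have := congrArg h.functor.map η.w
        simp only [Functor.map_comp] at this
        simp [← this] }
  associator f g h := mkIso (Functor.associator _ _ _) (by simp)
  leftUnitor f := mkIso (Functor.leftUnitor _) (by simp)
  rightUnitor f := mkIso (Functor.rightUnitor _) (by simp)
  whiskerLeft_id _ _ := by apply hom₂_ext; simp
  whiskerLeft_comp _ _ _ _ _ _ := by apply hom₂_ext; simp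
  id_whiskerLeft _ := by apply hom₂_ext; simp
  comp_whiskerLeft _ _ _ _ _ := by apply hom₂_ext; simp
  id_whiskerRight _ _ := by apply hom₂_ext; simp
  comp_whiskerRight _ _ _ := by apply hom₂_ext; simp
  whiskerRight_id _ := by apply hom₂_ext; simp
  whiskerRight_comp _ _ _ := by apply hom₂_ext; simp
  whisker_assoc _ _ _ _ _ := by apply hom₂_ext; simp
  whisker_exchange _ _ := by apply hom₂_ext; simp
  pentagon _ _ _ _ := by apply hom₂_ext; simp
  triangle _ _ := by apply hom₂_ext; simp

@[simp] theorem whiskerLeft_nat {X Y Z : CatStar.{v, u}} (f : X ⟶ Y) {g h : Y ⟶ Z} (η : g ⟶ h) :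
    (Bicategory.whiskerLeft f η).nat = Functor.whiskerLeft f.functor η.nat := rfl
@[simp] theorem whiskerRight_nat {X Y Z : CatStar.{v, u}} {f g : X ⟶ Y} (η : f ⟶ g) (h : Y ⟶ Z) :
    (Bicategory.whiskerRight η h).nat = Functor.whiskerRight η.nat h.functor := rfl

theorem hom_ext' {X Y : CatStar.{v, u}} {f g : X ⟶ Y} (h : f.functor = g.functor)
    (h' : f.map ≍ g.map) : f = g := by
  obtain ⟨F, φ⟩ := f
  obtain ⟨G, ψ⟩ := g
  obtain rfl : F = G := h
  obtain rfl : φ = ψ := eq_of_heq h'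
  rfl

theorem eqToHom_nat_app {X Y : CatStar.{v, u}} {f g : X ⟶ Y} (h : f = g) (x : X.carrier) :
    (eqToHom h : f ⟶ g).nat.app x = eqToHom (by rw [h]) := by
  subst h; rfl

instance strict : Bicategory.Strict CatStar.{v, u} where
  id_comp f := hom_ext' rfl (heq_of_eq (by simp))
  comp_id f := hom_ext' rfl (heq_of_eq (by simp))
  assoc f g h := hom_ext' rfl (heq_of_eq (by simp))
  leftUnitor_eqToIso f := by
    ext1; apply hom₂_ext; intro x
    simp only [eqToIso.hom, eqToHom_nat_app]; rfl
  rightUnitor_eqToIso f := by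
    ext1; apply hom₂_ext; intro x
    simp only [eqToIso.hom, eqToHom_nat_app]; rfl
  associator_eqToIso f g h := by
    ext1; apply hom₂_ext; intro x
    simp only [eqToIso.hom, eqToHom_nat_app]; rfl

/-- The object of the one-object, one-morphism category. -/
inductive Pt : Type u
  | star

instance : Category.{v} Pt.{u} where
  Hom _ _ := PUnit.{v + 1}
  id _ := ⟨⟩
  comp _ _ := ⟨⟩


open scoped CategoryTheory.Prod

/-- The tensor product of `Cat_*` is the product `(𝒳 × 𝒴, (X, Y))`; the unit is the terminal category. -/
instance monoidalStruct : MonoidalCategoryStruct CatStar.{v, u} where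
  tensorObj X Y := { carrier := X.carrier × Y.carrier, pt := (X.pt, Y.pt) }
  tensorUnit := { carrier := Pt.{u}, pt := Pt.star }
  tensorHom f g := { functor := f.functor.prod g.functor, map := f.map ×ₘ g.map }
  whiskerLeft X _ _ g :=
    { functor := (𝟭 X.carrier).prod g.functor, map := 𝟙 X.pt ×ₘ g.map }
  whiskerRight f Y :=
    { functor := f.functor.prod (𝟭 Y.carrier), map := f.map ×ₘ 𝟙 Y.pt }
  associator X Y Z :=
    { hom := { functor := prod.associator _ _ _, map := 𝟙 (X.pt, (Y.pt, Z.pt)) }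
      inv := { functor := prod.inverseAssociator _ _ _, map := 𝟙 ((X.pt, Y.pt), Z.pt) }
      hom_inv_id := hom_ext' rfl (heq_of_eq (Prod.ext
        (Prod.ext (Category.id_comp _) (Category.id_comp _)) (Category.id_comp _)))
      inv_hom_id := hom_ext' rfl (heq_of_eq (Prod.ext
        (Category.id_comp _) (Prod.ext (Category.id_comp _) (Category.id_comp _)))) }
  leftUnitor X :=
    { hom := { functor := CategoryTheory.Prod.snd _ _, map := 𝟙 X.pt }
      inv :=
        { functor := Functor.prod' ((Functor.const _).obj Pt.star) (𝟭 _)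
          map := 𝟙 (Pt.star, X.pt) }
      hom_inv_id := hom_ext' rfl (heq_of_eq (Prod.ext rfl (Category.id_comp _)))
      inv_hom_id := hom_ext' rfl (heq_of_eq (Category.id_comp _)) }
  rightUnitor X :=
    { hom := { functor := CategoryTheory.Prod.fst _ _, map := 𝟙 X.pt }
      inv :=
        { functor := Functor.prod' (𝟭 _) ((Functor.const _).obj Pt.star)
          map := 𝟙 (X.pt, Pt.star) }
      hom_inv_id := hom_ext' rfl (heq_of_eq (Prod.ext (Category.id_comp _) rfl))
      inv_hom_id := hom_ext' rfl (heq_of_eq (Category.id_comp _)) }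

open MonoidalCategory

instance monoidal : MonoidalCategory CatStar.{v, u} where
  tensorHom_def f g := hom_ext' rfl (heq_of_eq (Prod.ext
    (show f.map = f.map ≫ 𝟙 _ by simp) (show g.map = g.functor.map (𝟙 _) ≫ g.map by simp)))
  id_tensorHom_id X Y := hom_ext' rfl (heq_of_eq rfl)
  tensorHom_comp_tensorHom f g h k := hom_ext' rfl (heq_of_eq rfl)
  whiskerLeft_id X Y := hom_ext' rfl (heq_of_eq rfl)
  id_whiskerRight X Y := hom_ext' rfl (heq_of_eq rfl)
  associator_naturality f g h := hom_ext' rfl (heq_of_eq (Prod.ext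
    (show f.map ≫ 𝟙 _ = f.functor.map (𝟙 _) ≫ f.map by simp) (Prod.ext
    (show g.map ≫ 𝟙 _ = g.functor.map (𝟙 _) ≫ g.map by simp)
    (show h.map ≫ 𝟙 _ = h.functor.map (𝟙 _) ≫ h.map by simp))))
  leftUnitor_naturality f := hom_ext' rfl (heq_of_eq
    (show f.map ≫ 𝟙 _ = f.functor.map (𝟙 _) ≫ f.map by simp))
  rightUnitor_naturality f := hom_ext' rfl (heq_of_eq
    (show f.map ≫ 𝟙 _ = f.functor.map (𝟙 _) ≫ f.map by simp))
  pentagon W X Y Z := hom_ext' rfl (heq_of_eq (Prod.ext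
    (show (𝟙 _ ≫ 𝟙 _ ≫ 𝟙 _ : W.pt ⟶ W.pt) = 𝟙 _ ≫ 𝟙 _ by simp) (Prod.ext
    (show (𝟙 _ ≫ 𝟙 _ ≫ 𝟙 _ : X.pt ⟶ X.pt) = 𝟙 _ ≫ 𝟙 _ by simp) (Prod.ext
    (show (𝟙 _ ≫ 𝟙 _ ≫ 𝟙 _ : Y.pt ⟶ Y.pt) = 𝟙 _ ≫ 𝟙 _ by simp)
    (show (𝟙 _ ≫ 𝟙 _ ≫ 𝟙 _ : Z.pt ⟶ Z.pt) = 𝟙 _ ≫ 𝟙 _ by simp)))))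
  triangle X Y := hom_ext' rfl (heq_of_eq (Prod.ext
    (show (𝟙 _ ≫ 𝟙 _ : X.pt ⟶ X.pt) = 𝟙 _ by simp)
    (show (𝟙 _ ≫ 𝟙 _ : Y.pt ⟶ Y.pt) = 𝟙 _ by simp)))

instance braided : BraidedCategory CatStar.{v, u} where
  braiding X Y :=
    { hom := { functor := CategoryTheory.Prod.swap _ _, map := 𝟙 (Y.pt, X.pt) }
      inv := { functor := CategoryTheory.Prod.swap _ _, map := 𝟙 (X.pt, Y.pt) }
      hom_inv_id := hom_ext' rfl (heq_of_eq (Prod.ext (Category.id_comp _) (Category.id_comp _)))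
      inv_hom_id := hom_ext' rfl (heq_of_eq (Prod.ext (Category.id_comp _) (Category.id_comp _))) }
  braiding_naturality_right X Y Z f := hom_ext' rfl (heq_of_eq (Prod.ext
    (show f.map ≫ 𝟙 _ = f.functor.map (𝟙 _) ≫ f.map by simp) rfl))
  braiding_naturality_left f Z := hom_ext' rfl (heq_of_eq (Prod.ext rfl
    (show f.map ≫ 𝟙 _ = f.functor.map (𝟙 _) ≫ f.map by simp)))
  hexagon_forward X Y Z := hom_ext' rfl (heq_of_eq rfl)
  hexagon_reverse X Y Z := hom_ext' rfl (heq_of_eq rfl)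

instance symmetric : SymmetricCategory CatStar.{v, u} where
  symmetry X Y := hom_ext' rfl (heq_of_eq (Prod.ext (Category.id_comp _) (Category.id_comp _)))

end CatStar
universe w' v' u'

open CategoryTheory MonoidalCategory

infixr:81 " ◁₂ " => Bicategory.whiskerLeft
infixl:81 " ▷₂ " => Bicategory.whiskerRight

theorem tensor_cod {B : Type u'} [Category.{v'} B] [MonoidalCategory B] {U V X : B}
    (p : U ⟶ X) (q : V ⟶ X) (m : X ⊗ X ⟶ X) :
    ((𝟙 X ⊗ₘ p) ⊗ₘ q) ≫ (α_ X X X).hom ≫ (𝟙 X ⊗ₘ m) ≫ m =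
      (α_ X U V).hom ≫ (𝟙 X ⊗ₘ ((p ⊗ₘ q) ≫ m)) ≫ m := by
  simp only [associator_naturality_assoc, tensorHom_comp_tensorHom_assoc, Category.comp_id]

/-- An equality of 1-cells which is a consequence of the axioms of a (strict) symmetric monoidal
category; `h` is supplied automatically. -/
theorem strictEq {B : Type u'} [Category.{v'} B] {X Y : B} {f g : X ⟶ Y} (h : f = g := by
    first
    | (simp; done)
    | (simp only [Category.assoc, id_tensorHom_id, tensorHom_comp_tensorHom,
        tensorHom_comp_tensorHom_assoc, associator_naturality, associator_naturality_assoc,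
        Category.id_comp, Category.comp_id, BraidedCategory.braiding_naturality,
        BraidedCategory.braiding_naturality_assoc]; done)
    | (simp only [Category.assoc, id_tensorHom_id, tensorHom_comp_tensorHom,
        tensorHom_comp_tensorHom_assoc, associator_naturality_assoc, Category.id_comp,
        Category.comp_id]; done)
    | (simp only [Category.assoc, ← id_tensorHom_id, tensorHom_comp_tensorHom,
        tensorHom_comp_tensorHom_assoc, associator_naturality_assoc, Category.id_comp,
        Category.comp_id, ← id_tensorHom, ← tensorHom_id,
        BraidedCategory.braiding_naturality_assoc, BraidedCategory.hexagon_forward_assoc]; done)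
    | (simp only [Category.assoc, id_tensorHom_id, tensorHom_comp_tensorHom,
        tensorHom_comp_tensorHom_assoc, associator_naturality_assoc, Iso.inv_hom_id_assoc,
        Category.id_comp, Category.comp_id, ← id_tensorHom, ← tensorHom_id,
        BraidedCategory.braiding_tensor_left_hom]; done)
    | (simp [MonoidalCategory.tensorHom_def']; done)
    | (simp [MonoidalCategory.tensorHom_def]; done)
    | (simp only [Category.assoc, ← tensor_cod]
       simp only [id_tensorHom, tensorHom_id, BraidedCategory.braiding_tensor_left_hom,
         Category.assoc]; done)) : f = g := h

/-- The identity 2-cell between two equal 1-cells whose equality is a consequence of the axioms of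
a (strict) symmetric monoidal category (this equality is supplied automatically). In pasting
composites it plays the role of the equalities that are suppressed in a 2-categorical diagram. -/
abbrev strictId {B : Type u'} [Bicategory.{w', v'} B] {X Y : B} {f g : X ⟶ Y} (h : f = g := by
    first
    | (simp; done)
    | (simp only [Category.assoc, id_tensorHom_id, tensorHom_comp_tensorHom,
        tensorHom_comp_tensorHom_assoc, associator_naturality, associator_naturality_assoc,
        Category.id_comp, Category.comp_id, BraidedCategory.braiding_naturality,
        BraidedCategory.braiding_naturality_assoc]; done)
    | (simp only [Category.assoc, id_tensorHom_id, tensorHom_comp_tensorHom,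
        tensorHom_comp_tensorHom_assoc, associator_naturality_assoc, Category.id_comp,
        Category.comp_id]; done)
    | (simp only [Category.assoc, ← id_tensorHom_id, tensorHom_comp_tensorHom,
        tensorHom_comp_tensorHom_assoc, associator_naturality_assoc, Category.id_comp,
        Category.comp_id, ← id_tensorHom, ← tensorHom_id,
        BraidedCategory.braiding_naturality_assoc, BraidedCategory.hexagon_forward_assoc]; done)
    | (simp only [Category.assoc, id_tensorHom_id, tensorHom_comp_tensorHom,
        tensorHom_comp_tensorHom_assoc, associator_naturality_assoc, Iso.inv_hom_id_assoc,
        Category.id_comp, Category.comp_id, ← id_tensorHom, ← tensorHom_id,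
        BraidedCategory.braiding_tensor_left_hom]; done)
    | (simp [MonoidalCategory.tensorHom_def']; done)
    | (simp [MonoidalCategory.tensorHom_def]; done)
    | (simp only [Category.assoc, ← tensor_cod]
       simp only [id_tensorHom, tensorHom_id, BraidedCategory.braiding_tensor_left_hom,
         Category.assoc]; done)) : f ⟶ g := eqToHom h

section Strict

variable {B : Type u'} [Bicategory.{w', v'} B] [Bicategory.Strict B]

theorem paste_heq {X Y : B} {f f' g g' k k' h h' : X ⟶ Y} {η : f ⟶ g} {η' : f' ⟶ g'}
    {θ : k ⟶ h} {θ' : k' ⟶ h'} {e : g = k} {e' : g' = k'} (hη : η ≍ η') (hθ : θ ≍ θ')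
    (hf : f = f') (hg : g = g') (hh : h = h') :
    η ≫ eqToHom e ≫ θ ≍ η' ≫ eqToHom e' ≫ θ' := by
  subst e e' hf hg hh
  obtain rfl := eq_of_heq hη
  obtain rfl := eq_of_heq hθ
  rfl

theorem comp_heq {X Y : B} {f f' g g' h h' : X ⟶ Y} {η : f ⟶ g} {η' : f' ⟶ g'}
    {θ : g ⟶ h} {θ' : g' ⟶ h'} (hη : η ≍ η') (hθ : θ ≍ θ')
    (hf : f = f') (hg : g = g') (hh : h = h') : η ≫ θ ≍ η' ≫ θ' := by
  subst hf hg hh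
  obtain rfl := eq_of_heq hη
  obtain rfl := eq_of_heq hθ
  rfl

theorem conj_heq {X Y : B} {f g k h : X ⟶ Y} (η : g ⟶ k) (e : f = g) (e' : k = h) :
    eqToHom e ≫ η ≫ eqToHom e' ≍ η := by
  subst e e'; simp

theorem whiskerLeft_heq {X Y Z : B} {f f' : X ⟶ Y} {g g' h h' : Y ⟶ Z} {η : g ⟶ h} {η' : g' ⟶ h'}
    (hη : η ≍ η') (hf : f = f') (hg : g = g') (hh : h = h') :
    f ◁₂ η ≍ f' ◁₂ η' := by
  subst hf hg hh
  obtain rfl := eq_of_heq hη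
  rfl

theorem whiskerRight_heq {X Y Z : B} {f f' g g' : X ⟶ Y} {h h' : Y ⟶ Z} {η : f ⟶ g} {η' : f' ⟶ g'}
    (hη : η ≍ η') (hf : f = f') (hg : g = g') (hh : h = h') :
    η ▷₂ h ≍ η' ▷₂ h' := by
  subst hf hg hh
  obtain rfl := eq_of_heq hη
  rfl

theorem comp_whiskerLeft_heq {W X Y Z : B} (f : W ⟶ X) (g : X ⟶ Y) {h k : Y ⟶ Z} (η : h ⟶ k) :
    (f ≫ g) ◁₂ η ≍ f ◁₂ g ◁₂ η := by
  rw [Bicategory.comp_whiskerLeft, Bicategory.Strict.associator_eqToIso,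
    Bicategory.Strict.associator_eqToIso]
  exact conj_heq _ (Category.assoc _ _ _) (Category.assoc _ _ _).symm

theorem whiskerRight_comp_heq {W X Y Z : B} {f g : W ⟶ X} (η : f ⟶ g) (h : X ⟶ Y) (k : Y ⟶ Z) :
    η ▷₂ (h ≫ k) ≍ (η ▷₂ h) ▷₂ k := by
  rw [Bicategory.whiskerRight_comp, Bicategory.Strict.associator_eqToIso,
    Bicategory.Strict.associator_eqToIso]
  exact conj_heq _ (Category.assoc _ _ _).symm (Category.assoc _ _ _)

theorem whisker_assoc_heq {W X Y Z : B} (f : W ⟶ X) {g h : X ⟶ Y} (η : g ⟶ h) (k : Y ⟶ Z) :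
    (f ◁₂ η) ▷₂ k ≍ f ◁₂ (η ▷₂ k) := by
  rw [Bicategory.whisker_assoc, Bicategory.Strict.associator_eqToIso,
    Bicategory.Strict.associator_eqToIso]
  exact conj_heq _ (Category.assoc _ _ _) (Category.assoc _ _ _).symm

end Strict

/-- A symmetric monoidal 2-category, strict in the sense of `Cat`-enrichment: a 2-category `B` whose
underlying category is symmetric monoidal, with the tensor product extended to 2-cells
(`tensor₂ η θ : f ⊗ g ⟶ f' ⊗ g'`) so that it is a 2-functor and so that the associativity, unit and
symmetry isomorphisms are 2-natural. -/
class SymmetricMonoidalTwoCategory (B : Type u') [Bicategory.{w', v'} B] [Bicategory.Strict B]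
    [MonoidalCategory B] [SymmetricCategory B] where
  tensor₂ {W X Y Z : B} {f f' : W ⟶ X} {g g' : Y ⟶ Z} (η : f ⟶ f') (θ : g ⟶ g') :
    (f ⊗ₘ g) ⟶ (f' ⊗ₘ g')
  tensor₂_id {W X Y Z : B} (f : W ⟶ X) (g : Y ⟶ Z) : tensor₂ (𝟙 f) (𝟙 g) = 𝟙 (f ⊗ₘ g)
  tensor₂_comp {W X Y Z : B} {f f' f'' : W ⟶ X} {g g' g'' : Y ⟶ Z}
    (η : f ⟶ f') (η' : f' ⟶ f'') (θ : g ⟶ g') (θ' : g' ⟶ g'') :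
    tensor₂ (η ≫ η') (θ ≫ θ') = tensor₂ η θ ≫ tensor₂ η' θ'
  tensor₂_whiskerLeft {V W X V' W' X' : B} (h : V ⟶ W) (k : V' ⟶ W')
    {f f' : W ⟶ X} {g g' : W' ⟶ X'} (η : f ⟶ f') (θ : g ⟶ g') :
    tensor₂ (h ◁₂ η) (k ◁₂ θ) =
      strictId ≫ ((h ⊗ₘ k) ◁₂ tensor₂ η θ) ≫ strictId
  tensor₂_whiskerRight {V W X V' W' X' : B} {f f' : V ⟶ W} {g g' : V' ⟶ W'}
    (η : f ⟶ f') (θ : g ⟶ g') (h : W ⟶ X) (k : W' ⟶ X') :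
    tensor₂ (η ▷₂ h) (θ ▷₂ k) =
      strictId ≫ (tensor₂ η θ ▷₂ (h ⊗ₘ k)) ≫ strictId
  associator_natural {X X' Y Y' Z Z' : B} {f f' : X ⟶ X'} {g g' : Y ⟶ Y'} {h h' : Z ⟶ Z'}
    (η : f ⟶ f') (θ : g ⟶ g') (κ : h ⟶ h') :
    tensor₂ (tensor₂ η θ) κ ▷₂ (α_ X' Y' Z').hom =
      strictId ≫ ((α_ X Y Z).hom ◁₂ tensor₂ η (tensor₂ θ κ)) ≫ strictId
  leftUnitor_natural {X X' : B} {f f' : X ⟶ X'} (η : f ⟶ f') :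
    tensor₂ (𝟙 (𝟙 (𝟙_ B))) η ▷₂ (λ_ X').hom =
      strictId ≫ ((λ_ X).hom ◁₂ η) ≫ strictId
  rightUnitor_natural {X X' : B} {f f' : X ⟶ X'} (η : f ⟶ f') :
    tensor₂ η (𝟙 (𝟙 (𝟙_ B))) ▷₂ (ρ_ X').hom =
      strictId ≫ ((ρ_ X).hom ◁₂ η) ≫ strictId
  braiding_natural {X X' Y Y' : B} {f f' : X ⟶ X'} {g g' : Y ⟶ Y'} (η : f ⟶ f') (θ : g ⟶ g') :
    tensor₂ η θ ▷₂ (β_ X' Y').hom =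
      strictId ≫ ((β_ X Y).hom ◁₂ tensor₂ θ η) ≫ strictId

infixr:70 " ⊠₂ " => SymmetricMonoidalTwoCategory.tensor₂

section General

variable {B : Type u'} [Bicategory.{w', v'} B] [Bicategory.Strict B]
    [MonoidalCategory B] [SymmetricCategory B] [SymmetricMonoidalTwoCategory B]

/-- A pseudomonoid structure on an object `X` of a symmetric monoidal 2-category: a multiplication,
a unit, invertible associativity and unit 2-cells, subject to the pentagon and triangle axioms.
For the 2-category `Cat` this is a monoidal category. -/
structure Pseudomonoid (X : B) where
  mul : X ⊗ X ⟶ X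
  one : 𝟙_ B ⟶ X
  assoc : (mul ⊗ₘ 𝟙 X) ≫ mul ≅ (α_ X X X).hom ≫ (𝟙 X ⊗ₘ mul) ≫ mul
  oneMul : (one ⊗ₘ 𝟙 X) ≫ mul ≅ (λ_ X).hom
  mulOne : (𝟙 X ⊗ₘ one) ≫ mul ≅ (ρ_ X).hom
  pentagon :
    ((assoc.hom ⊠₂ 𝟙 (𝟙 X)) ▷₂ mul) ≫ strictId ≫
      ((((α_ X X X).hom ⊗ₘ 𝟙 X) ≫ ((𝟙 X ⊗ₘ mul) ⊗ₘ 𝟙 X)) ◁₂ assoc.hom) ≫ strictId ≫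
      ((((α_ X X X).hom ⊗ₘ 𝟙 X) ≫ (α_ X (X ⊗ X) X).hom) ◁₂ ((𝟙 (𝟙 X) ⊠₂ assoc.hom) ▷₂ mul)) =
    strictId ≫
      (((mul ⊗ₘ 𝟙 X) ⊗ₘ 𝟙 X) ◁₂ assoc.hom) ≫
      strictId ≫
      (((α_ (X ⊗ X) X X).hom ≫ (𝟙 (X ⊗ X) ⊗ₘ mul)) ◁₂ assoc.hom) ≫ strictId
  triangle :
    ((mulOne.hom ⊠₂ 𝟙 (𝟙 X)) ▷₂ mul) =
    strictId ≫
      (((𝟙 X ⊗ₘ one) ⊗ₘ 𝟙 X) ◁₂ assoc.hom) ≫ strictId ≫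
      ((α_ X (𝟙_ B) X).hom ◁₂ ((𝟙 (𝟙 X) ⊠₂ oneMul.hom) ▷₂ mul)) ≫ strictId

/-- A braided pseudomonoid: a pseudomonoid with an invertible 2-cell `mul ≅ β ≫ mul` satisfying the
two hexagon axioms. -/
structure BraidedPseudomonoid (X : B) extends Pseudomonoid X where
  braiding : mul ≅ (β_ X X).hom ≫ mul
  hexagon_forward :
    assoc.hom ≫ strictId ≫
      (((α_ X X X).hom ≫ (𝟙 X ⊗ₘ mul)) ◁₂ braiding.hom) ≫ strictId ≫
      (((α_ X X X).hom ≫ (β_ X (X ⊗ X)).hom) ◁₂ assoc.hom) =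
    ((braiding.hom ⊠₂ 𝟙 (𝟙 X)) ▷₂ mul) ≫ strictId ≫
      (((β_ X X).hom ⊗ₘ 𝟙 X) ◁₂ assoc.hom) ≫ strictId ≫
      ((((β_ X X).hom ⊗ₘ 𝟙 X) ≫ (α_ X X X).hom) ◁₂ ((𝟙 (𝟙 X) ⊠₂ braiding.hom) ▷₂ mul)) ≫
      strictId
  hexagon_reverse :
    ((α_ X X X).inv ◁₂ assoc.inv) ≫ strictId ≫
      (((α_ X X X).inv ≫ (mul ⊗ₘ 𝟙 X)) ◁₂ braiding.hom) ≫ strictId ≫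
      (((α_ X X X).inv ≫ (β_ (X ⊗ X) X).hom ≫ (α_ X X X).inv) ◁₂ assoc.inv) =
    strictId ≫ ((𝟙 (𝟙 X) ⊠₂ braiding.hom) ▷₂ mul) ≫ strictId ≫
      (((𝟙 X ⊗ₘ (β_ X X).hom) ≫ (α_ X X X).inv) ◁₂ assoc.inv) ≫ strictId ≫
      (((𝟙 X ⊗ₘ (β_ X X).hom) ≫ (α_ X X X).inv) ◁₂ ((braiding.hom ⊠₂ 𝟙 (𝟙 X)) ▷₂ mul)) ≫
      strictId

/-- A strong monoidal structure on a 1-cell between pseudomonoids. -/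
structure PseudomonoidHom {X Y : B} (M : Pseudomonoid X) (N : Pseudomonoid Y) (f : X ⟶ Y) where
  mulIso : (f ⊗ₘ f) ≫ N.mul ≅ M.mul ≫ f
  oneIso : N.one ≅ M.one ≫ f
  associativity :
    ((mulIso.hom ⊠₂ 𝟙 f) ▷₂ N.mul) ≫ strictId ≫
      ((M.mul ⊗ₘ 𝟙 X) ◁₂ mulIso.hom) ≫ strictId ≫ (M.assoc.hom ▷₂ f) =
    strictId ≫ (((f ⊗ₘ f) ⊗ₘ f) ◁₂ N.assoc.hom) ≫ strictId ≫
      ((α_ X X X).hom ◁₂ ((𝟙 f ⊠₂ mulIso.hom) ▷₂ N.mul)) ≫ strictId ≫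
      (((α_ X X X).hom ≫ (𝟙 X ⊗ₘ M.mul)) ◁₂ mulIso.hom) ≫ strictId
  left_unitality :
    ((oneIso.hom ⊠₂ 𝟙 f) ▷₂ N.mul) ≫ strictId ≫
      ((M.one ⊗ₘ 𝟙 X) ◁₂ mulIso.hom) ≫ strictId ≫ (M.oneMul.hom ▷₂ f) =
    strictId ≫ ((𝟙 (𝟙_ B) ⊗ₘ f) ◁₂ N.oneMul.hom) ≫ strictId
  right_unitality :
    ((𝟙 f ⊠₂ oneIso.hom) ▷₂ N.mul) ≫ strictId ≫
      ((𝟙 X ⊗ₘ M.one) ◁₂ mulIso.hom) ≫ strictId ≫ (M.mulOne.hom ▷₂ f) =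
    strictId ≫ ((f ⊗ₘ 𝟙 (𝟙_ B)) ◁₂ N.mulOne.hom) ≫ strictId

/-- A centre piece for the pseudomonoid `M` on `X` with domain `U`, that is, an object of the descent
category of the Hochschild diagram `Hom(U, X) ⇉ Hom(U ⊗ X, X) ⇛ Hom(U ⊗ X ⊗ X, X)`: a 1-cell
`p : U ⟶ X`, an invertible 2-cell `γ` with components `p u · x ≅ x · p u` between its two images
(multiplication by `X` on the right and on the left), subject to the cocycle condition
`γ_{u, x · y} = (γ_{u, x} · y) ≫ (x · γ_{u, y})` (up to associativity) and the normalization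
condition on the unit of `M`. -/
structure CentrePiece {X : B} (M : Pseudomonoid X) (U : B) where
  hom : U ⟶ X
  γ : (hom ⊗ₘ 𝟙 X) ≫ M.mul ≅ (β_ U X).hom ≫ (𝟙 X ⊗ₘ hom) ≫ M.mul
  cocycle :
    ((γ.hom ⊠₂ 𝟙 (𝟙 X)) ▷₂ M.mul) ≫ strictId ≫
      ((((β_ U X).hom ⊗ₘ 𝟙 X) ≫ ((𝟙 X ⊗ₘ hom) ⊗ₘ 𝟙 X)) ◁₂ M.assoc.hom) ≫ strictId ≫
      ((((β_ U X).hom ⊗ₘ 𝟙 X) ≫ (α_ X U X).hom) ◁₂ ((𝟙 (𝟙 X) ⊠₂ γ.hom) ▷₂ M.mul)) =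
    strictId ≫ (((hom ⊗ₘ 𝟙 X) ⊗ₘ 𝟙 X) ◁₂ M.assoc.hom) ≫ strictId ≫
      (((α_ U X X).hom ≫ (𝟙 U ⊗ₘ M.mul)) ◁₂ γ.hom) ≫ strictId ≫
      (((α_ U X X).hom ≫ (β_ U (X ⊗ X)).hom ≫ (𝟙 (X ⊗ X) ⊗ₘ hom)) ◁₂ M.assoc.hom) ≫
      strictId
  unit :
    ((𝟙 U ⊗ₘ M.one) ◁₂ γ.hom) ≫ strictId ≫
      (((β_ U (𝟙_ B)).hom ≫ (𝟙 (𝟙_ B) ⊗ₘ hom)) ◁₂ M.oneMul.hom) =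
    strictId ≫ ((hom ⊗ₘ 𝟙 (𝟙_ B)) ◁₂ M.mulOne.hom) ≫ strictId



end General

section Restriction

variable {B : Type u'} [Bicategory.{w', v'} B] [Bicategory.Strict B]
    [MonoidalCategory B] [SymmetricCategory B] [SymmetricMonoidalTwoCategory B]

theorem tensor₂_heq {W X Y Z : B} {f f' k k' : W ⟶ X} {g g' l l' : Y ⟶ Z}
    {η : f ⟶ f'} {η' : k ⟶ k'} {θ : g ⟶ g'} {θ' : l ⟶ l'} (hη : η ≍ η') (hθ : θ ≍ θ')
    (h₁ : f = k) (h₂ : f' = k') (h₃ : g = l) (h₄ : g' = l') : η ⊠₂ θ ≍ η' ⊠₂ θ' := by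
  subst h₁ h₂ h₃ h₄
  obtain rfl := eq_of_heq hη
  obtain rfl := eq_of_heq hθ
  rfl

theorem id_heq {X Y : B} {f g : X ⟶ Y} (h : f = g) : 𝟙 f ≍ 𝟙 g := by subst h; rfl

theorem whiskerLeft_tensor₂_id_heq {V W X Y : B} (h : V ⟶ W) {f g : W ⟶ X} (η : f ⟶ g) :
    (h ◁₂ η) ⊠₂ 𝟙 (𝟙 Y) ≍ (h ⊗ₘ 𝟙 Y) ◁₂ (η ⊠₂ 𝟙 (𝟙 Y)) := by
  have e : 𝟙 (𝟙 Y) ≍ 𝟙 Y ◁₂ 𝟙 (𝟙 Y) := by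
    rw [Bicategory.whiskerLeft_id]; exact id_heq (by simp)
  refine (tensor₂_heq HEq.rfl e rfl rfl (by simp) (by simp)).trans ?_
  rw [SymmetricMonoidalTwoCategory.tensor₂_whiskerLeft]
  exact conj_heq _ _ _

theorem id_tensor₂_whiskerLeft_heq {V W X Y : B} (h : V ⟶ W) {f g : W ⟶ X} (η : f ⟶ g) :
    𝟙 (𝟙 Y) ⊠₂ (h ◁₂ η) ≍ (𝟙 Y ⊗ₘ h) ◁₂ (𝟙 (𝟙 Y) ⊠₂ η) := by
  have e : 𝟙 (𝟙 Y) ≍ 𝟙 Y ◁₂ 𝟙 (𝟙 Y) := by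
    rw [Bicategory.whiskerLeft_id]; exact id_heq (by simp)
  refine (tensor₂_heq e HEq.rfl (by simp) (by simp) rfl rfl).trans ?_
  rw [SymmetricMonoidalTwoCategory.tensor₂_whiskerLeft]
  exact conj_heq _ _ _

theorem whiskerRight_tensor₂_id_heq {V W X Y : B} {f g : V ⟶ W} (η : f ⟶ g) (h : W ⟶ X) :
    (η ▷₂ h) ⊠₂ 𝟙 (𝟙 Y) ≍ (η ⊠₂ 𝟙 (𝟙 Y)) ▷₂ (h ⊗ₘ 𝟙 Y) := by
  have e : 𝟙 (𝟙 Y) ≍ 𝟙 (𝟙 Y) ▷₂ 𝟙 Y := by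
    rw [Bicategory.id_whiskerRight]; exact id_heq (by simp)
  refine (tensor₂_heq HEq.rfl e rfl rfl (by simp) (by simp)).trans ?_
  rw [SymmetricMonoidalTwoCategory.tensor₂_whiskerRight]
  exact conj_heq _ _ _

theorem id_tensor₂_whiskerRight_heq {V W X Y : B} {f g : V ⟶ W} (η : f ⟶ g) (h : W ⟶ X) :
    𝟙 (𝟙 Y) ⊠₂ (η ▷₂ h) ≍ (𝟙 (𝟙 Y) ⊠₂ η) ▷₂ (𝟙 Y ⊗ₘ h) := by
  have e : 𝟙 (𝟙 Y) ≍ 𝟙 (𝟙 Y) ▷₂ 𝟙 Y := by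
    rw [Bicategory.id_whiskerRight]; exact id_heq (by simp)
  refine (tensor₂_heq e HEq.rfl (by simp) (by simp) rfl rfl).trans ?_
  rw [SymmetricMonoidalTwoCategory.tensor₂_whiskerRight]
  exact conj_heq _ _ _

namespace CentrePiece

variable {X : B} {M : Pseudomonoid X}

/-- Morphisms of centre pieces: 2-cells between the underlying 1-cells which commute with `γ`. -/
@[ext]
structure Hom {U : B} (P Q : CentrePiece M U) where
  cell : P.hom ⟶ Q.hom
  comm : ((cell ⊠₂ 𝟙 (𝟙 X)) ▷₂ M.mul) ≫ Q.γ.hom =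
    P.γ.hom ≫ ((β_ U X).hom ◁₂ ((𝟙 (𝟙 X) ⊠₂ cell) ▷₂ M.mul))

/-- The category `CP(U, M)` of centre pieces with domain `U`. -/
instance (U : B) : Category (CentrePiece M U) where
  Hom P Q := Hom P Q
  id P :=
    { cell := 𝟙 P.hom
      comm := by simp [SymmetricMonoidalTwoCategory.tensor₂_id] }
  comp {P Q R} σ τ :=
    { cell := σ.cell ≫ τ.cell
      comm := by
        have h₁ : (σ.cell ≫ τ.cell) ⊠₂ 𝟙 (𝟙 X) =
            (σ.cell ⊠₂ 𝟙 (𝟙 X)) ≫ (τ.cell ⊠₂ 𝟙 (𝟙 X)) := by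
          rw [← SymmetricMonoidalTwoCategory.tensor₂_comp, Category.comp_id]
        have h₂ : 𝟙 (𝟙 X) ⊠₂ (σ.cell ≫ τ.cell) =
            (𝟙 (𝟙 X) ⊠₂ σ.cell) ≫ (𝟙 (𝟙 X) ⊠₂ τ.cell) := by
          rw [← SymmetricMonoidalTwoCategory.tensor₂_comp, Category.comp_id]
        rw [h₁, h₂, Bicategory.comp_whiskerRight, Bicategory.comp_whiskerRight,
          Bicategory.whiskerLeft_comp, Category.assoc, τ.comm, reassoc_of% σ.comm] }
  id_comp σ := Hom.ext (Category.id_comp _)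
  comp_id σ := Hom.ext (Category.comp_id _)
  assoc σ τ υ := Hom.ext (Category.assoc _ _ _)

variable {U V : B}

theorem restrict_cod (P : CentrePiece M U) (h : V ⟶ U) :
    (β_ V X).hom ≫ (𝟙 X ⊗ₘ (h ≫ P.hom)) ≫ M.mul =
      (h ⊗ₘ 𝟙 X) ≫ (β_ U X).hom ≫ (𝟙 X ⊗ₘ P.hom) ≫ M.mul := by
  simp

theorem braiding_shift (h : V ⟶ U) (Y : B) :
    ((β_ V X).hom ⊗ₘ 𝟙 Y) ≫ (α_ X V Y).hom ≫ (𝟙 X ⊗ₘ (h ⊗ₘ 𝟙 Y)) =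
      ((h ⊗ₘ 𝟙 X) ⊗ₘ 𝟙 Y) ≫ ((β_ U X).hom ⊗ₘ 𝟙 Y) ≫ (α_ X U Y).hom := by
  rw [← associator_naturality, tensorHom_comp_tensorHom_assoc, tensorHom_comp_tensorHom_assoc,
    BraidedCategory.braiding_naturality]

theorem restrict_cod₂ (P : CentrePiece M U) (h : V ⟶ U) :
    (((β_ V X).hom ⊗ₘ 𝟙 X) ≫ (α_ X V X).hom) ≫
      (𝟙 X ⊗ₘ ((β_ V X).hom ≫ (𝟙 X ⊗ₘ (h ≫ P.hom)) ≫ M.mul)) ≫ M.mul =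
    ((h ⊗ₘ 𝟙 X) ⊗ₘ 𝟙 X) ≫ (((β_ U X).hom ⊗ₘ 𝟙 X) ≫ (α_ X U X).hom) ≫
      (𝟙 X ⊗ₘ ((β_ U X).hom ≫ (𝟙 X ⊗ₘ P.hom) ≫ M.mul)) ≫ M.mul := by
  have e : (𝟙 X ⊗ₘ ((h ⊗ₘ 𝟙 X) ≫ (β_ U X).hom ≫ (𝟙 X ⊗ₘ P.hom) ≫ M.mul)) =
      (𝟙 X ⊗ₘ (h ⊗ₘ 𝟙 X)) ≫ (𝟙 X ⊗ₘ ((β_ U X).hom ≫ (𝟙 X ⊗ₘ P.hom) ≫ M.mul)) := by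
    rw [tensorHom_comp_tensorHom, Category.comp_id]
  have s := congrArg (fun t => t ≫ (𝟙 X ⊗ₘ ((β_ U X).hom ≫ (𝟙 X ⊗ₘ P.hom) ≫ M.mul)) ≫ M.mul)
    (braiding_shift (X := X) h X)
  simp only [Category.assoc] at s
  rw [P.restrict_cod h, e]
  simp only [Category.assoc]
  exact s

/-- The 2-cell of the restriction of a centre piece along `h`. -/
def restrictγ (P : CentrePiece M U) (h : V ⟶ U) :
    ((h ≫ P.hom) ⊗ₘ 𝟙 X) ≫ M.mul ≅ (β_ V X).hom ≫ (𝟙 X ⊗ₘ (h ≫ P.hom)) ≫ M.mul :=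
  eqToIso (by simp) ≪≫ Bicategory.whiskerLeftIso (h ⊗ₘ 𝟙 X) P.γ ≪≫ eqToIso (by simp)

theorem restrictγ_heq (P : CentrePiece M U) (h : V ⟶ U) :
    (P.restrictγ h).hom ≍ (h ⊗ₘ 𝟙 X) ◁₂ P.γ.hom := by
  simp only [restrictγ, Iso.trans_hom, eqToIso.hom]
  exact conj_heq _ _ _

theorem restrictγ_tensor₂_id_heq (P : CentrePiece M U) (h : V ⟶ U) :
    ((P.restrictγ h).hom ⊠₂ 𝟙 (𝟙 X)) ▷₂ M.mul ≍
      ((h ⊗ₘ 𝟙 X) ⊗ₘ 𝟙 X) ◁₂ ((P.γ.hom ⊠₂ 𝟙 (𝟙 X)) ▷₂ M.mul) := by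
  refine (whiskerRight_heq ((tensor₂_heq (P.restrictγ_heq h) HEq.rfl (by simp)
    (P.restrict_cod h) rfl rfl).trans (whiskerLeft_tensor₂_id_heq _ _)) (by simp)
    (by rw [P.restrict_cod h, tensorHom_comp_tensorHom, Category.comp_id]) rfl).trans ?_
  exact whisker_assoc_heq _ _ _

theorem id_tensor₂_restrictγ_heq (P : CentrePiece M U) (h : V ⟶ U) :
    (𝟙 (𝟙 X) ⊠₂ (P.restrictγ h).hom) ▷₂ M.mul ≍
      (𝟙 X ⊗ₘ (h ⊗ₘ 𝟙 X)) ◁₂ ((𝟙 (𝟙 X) ⊠₂ P.γ.hom) ▷₂ M.mul) := by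
  refine (whiskerRight_heq ((tensor₂_heq HEq.rfl (P.restrictγ_heq h) rfl rfl (by simp)
    (P.restrict_cod h)).trans (id_tensor₂_whiskerLeft_heq _ _)) (by simp)
    (by rw [P.restrict_cod h, tensorHom_comp_tensorHom, Category.comp_id]) rfl).trans ?_
  exact whisker_assoc_heq _ _ _


/-- The centre piece `h^* P` on `V` obtained from a centre piece `P` on `U` and `h : V ⟶ U`. -/
def restrict (P : CentrePiece M U) (h : V ⟶ U) : CentrePiece M V where
  hom := h ≫ P.hom
  γ := P.restrictγ h
  cocycle := by
    have key := congrArg (fun t => ((h ⊗ₘ 𝟙 X) ⊗ₘ 𝟙 X) ◁₂ t) P.cocycle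
    simp only [Bicategory.whiskerLeft_comp, Bicategory.whiskerLeft_eqToHom] at key
    refine eq_of_heq ?_
    refine HEq.trans ?_ ((heq_of_eq key).trans ?_)
    · refine paste_heq (P.restrictγ_tensor₂_id_heq h) (paste_heq ?_ ?_ ?_ ?_ ?_) ?_ ?_ ?_
      · refine HEq.trans ?_ (comp_whiskerLeft_heq _ _ _)
        refine whiskerLeft_heq HEq.rfl ?_ rfl rfl
        exact strictEq
      · refine (whiskerLeft_heq (P.id_tensor₂_restrictγ_heq h) rfl ?_ ?_).trans
          ((comp_whiskerLeft_heq _ _ _).symm.trans ((whiskerLeft_heq HEq.rfl ?_ rfl rfl).trans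
            (comp_whiskerLeft_heq _ _ _)))
        all_goals
          first
          | exact (Category.assoc _ _ _).trans (braiding_shift h X)
          | exact P.restrict_cod₂ h
          | exact (P.restrict_cod₂ h).symm
          | exact strictEq
      all_goals
        first
        | exact (Category.assoc _ _ _).trans (braiding_shift h X)
        | exact P.restrict_cod₂ h
        | exact (P.restrict_cod₂ h).symm
        | exact strictEq
    · refine (eqToHom_comp_heq _ _).trans (HEq.trans ?_ (eqToHom_comp_heq _ _).symm)
      refine paste_heq ?_ (paste_heq ?_ (HEq.trans (comp_eqToHom_heq _ _) (HEq.trans ?_ (comp_eqToHom_heq _ _).symm)) ?_ ?_ ?_) ?_ ?_ ?_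
      · refine HEq.trans (comp_whiskerLeft_heq _ _ _).symm ?_
        refine whiskerLeft_heq HEq.rfl ?_ rfl rfl
        exact strictEq
      · refine HEq.trans (comp_whiskerLeft_heq _ _ _).symm (HEq.trans ?_ (whiskerLeft_heq (P.restrictγ_heq h).symm rfl ?_ ?_))
        refine HEq.trans ?_ (comp_whiskerLeft_heq _ _ _)
        refine whiskerLeft_heq HEq.rfl ?_ rfl rfl
        all_goals
          exact strictEq
      · refine HEq.trans (comp_whiskerLeft_heq _ _ _).symm ?_
        refine whiskerLeft_heq HEq.rfl ?_ rfl rfl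
        exact strictEq
      all_goals
        first
        | exact (Category.assoc _ _ _).trans (braiding_shift h X)
        | exact P.restrict_cod₂ h
        | exact (P.restrict_cod₂ h).symm
        | exact strictEq
  unit := by
    have key := congrArg (fun t => (h ⊗ₘ 𝟙 (𝟙_ B)) ◁₂ t) P.unit
    simp only [Bicategory.whiskerLeft_comp, Bicategory.whiskerLeft_eqToHom] at key
    refine eq_of_heq ?_
    refine HEq.trans ?_ ((heq_of_eq key).trans ?_)
    · refine paste_heq ?_ ?_ ?_ ?_ ?_
      · refine (whiskerLeft_heq (P.restrictγ_heq h) rfl ?_ ?_).trans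
          ((comp_whiskerLeft_heq _ _ _).symm.trans ((whiskerLeft_heq HEq.rfl ?_ rfl rfl).trans
            (comp_whiskerLeft_heq _ _ _)))
        all_goals
          exact strictEq
      · refine HEq.trans ?_ (comp_whiskerLeft_heq _ _ _)
        refine whiskerLeft_heq HEq.rfl ?_ rfl rfl
        all_goals
          exact strictEq
      all_goals
        exact strictEq
    · refine (eqToHom_comp_heq _ _).trans (HEq.trans ?_ (eqToHom_comp_heq _ _).symm)
      refine (HEq.trans (comp_eqToHom_heq _ _) (HEq.trans ?_ (comp_eqToHom_heq _ _).symm))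
      refine HEq.trans (comp_whiskerLeft_heq _ _ _).symm ?_
      refine whiskerLeft_heq HEq.rfl ?_ rfl rfl
      exact strictEq

theorem whisker_comm (P : CentrePiece M U) {h k : V ⟶ U} (σ : h ⟶ k) :
    (((σ ▷₂ P.hom) ⊠₂ 𝟙 (𝟙 X)) ▷₂ M.mul) ≫ (P.restrict k).γ.hom =
      (P.restrict h).γ.hom ≫ ((β_ V X).hom ◁₂ ((𝟙 (𝟙 X) ⊠₂ (σ ▷₂ P.hom)) ▷₂ M.mul)) := by
  have key := Bicategory.whisker_exchange (σ ⊠₂ 𝟙 (𝟙 X)) P.γ.hom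
  have h₁ : ((σ ▷₂ P.hom) ⊠₂ 𝟙 (𝟙 X)) ▷₂ M.mul ≍
      (σ ⊠₂ 𝟙 (𝟙 X)) ▷₂ ((P.hom ⊗ₘ 𝟙 X) ≫ M.mul) :=
    (whiskerRight_heq (whiskerRight_tensor₂_id_heq σ P.hom) (by simp) (by simp) rfl).trans
      (whiskerRight_comp_heq _ _ _).symm
  have h₂ : (𝟙 (𝟙 X) ⊠₂ (σ ▷₂ P.hom)) ▷₂ M.mul ≍
      (𝟙 (𝟙 X) ⊠₂ σ) ▷₂ ((𝟙 X ⊗ₘ P.hom) ≫ M.mul) :=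
    (whiskerRight_heq (id_tensor₂_whiskerRight_heq σ P.hom) (by simp) (by simp) rfl).trans
      (whiskerRight_comp_heq _ _ _).symm
  have h₃ : (σ ⊠₂ 𝟙 (𝟙 X)) ▷₂ (β_ U X).hom ≍ (β_ V X).hom ◁₂ (𝟙 (𝟙 X) ⊠₂ σ) := by
    rw [SymmetricMonoidalTwoCategory.braiding_natural]
    exact conj_heq _ _ _
  have h₄ : (β_ V X).hom ◁₂ ((𝟙 (𝟙 X) ⊠₂ (σ ▷₂ P.hom)) ▷₂ M.mul) ≍
      (σ ⊠₂ 𝟙 (𝟙 X)) ▷₂ ((β_ U X).hom ≫ (𝟙 X ⊗ₘ P.hom) ≫ M.mul) := by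
    refine (whiskerLeft_heq h₂ rfl (by simp) (by simp)).trans ?_
    refine (whisker_assoc_heq _ _ _).symm.trans ?_
    refine (whiskerRight_heq h₃.symm (BraidedCategory.braiding_naturality _ _).symm
      (BraidedCategory.braiding_naturality _ _).symm rfl).trans ?_
    exact (whiskerRight_comp_heq _ _ _).symm
  refine eq_of_heq ?_
  refine (comp_heq h₁ (P.restrictγ_heq k) (by simp) (by simp) (P.restrict_cod k)).trans ?_
  refine (heq_of_eq key.symm).trans ?_
  exact (comp_heq (P.restrictγ_heq h) h₄ (by simp) (P.restrict_cod h) (P.restrict_cod k)).symm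

/-- The functor `Hom(V, U) ⥤ CP(V, M)`, `h ↦ h^* P`, induced by a centre piece `P` on `U`. -/
def restrictFunctor (P : CentrePiece M U) (V : B) : (V ⟶ U) ⥤ CentrePiece M V where
  obj h := P.restrict h
  map σ := { cell := σ ▷₂ P.hom, comm := P.whisker_comm σ }
  map_id h := Hom.ext (Bicategory.id_whiskerRight h P.hom)
  map_comp σ τ := Hom.ext (Bicategory.comp_whiskerRight σ τ P.hom)

/-- The 2-cell `γ` of the tensor product `(P.hom ⊗ Q.hom) ≫ mul` of two centre pieces, with
components `(p · q) · x ≅ p · (q · x) ≅ p · (x · q) ≅ (p · x) · q ≅ (x · p) · q ≅ x · (p · q)`. -/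
def tensorCell (P : CentrePiece M U) (Q : CentrePiece M V) :
    (((P.hom ⊗ₘ Q.hom) ≫ M.mul) ⊗ₘ 𝟙 X) ≫ M.mul ⟶
      (β_ (U ⊗ V) X).hom ≫ (𝟙 X ⊗ₘ ((P.hom ⊗ₘ Q.hom) ≫ M.mul)) ≫ M.mul :=
  strictId ≫ (((P.hom ⊗ₘ Q.hom) ⊗ₘ 𝟙 X) ◁₂ M.assoc.hom) ≫ strictId ≫
    ((α_ U V X).hom ◁₂ ((𝟙 P.hom ⊠₂ Q.γ.hom) ▷₂ M.mul)) ≫ strictId ≫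
    (((α_ U V X).hom ≫ (𝟙 U ⊗ₘ (β_ V X).hom) ≫ (α_ U X V).inv ≫
      ((P.hom ⊗ₘ 𝟙 X) ⊗ₘ Q.hom)) ◁₂ M.assoc.inv) ≫ strictId ≫
    (((α_ U V X).hom ≫ (𝟙 U ⊗ₘ (β_ V X).hom) ≫ (α_ U X V).inv) ◁₂
      ((P.γ.hom ⊠₂ 𝟙 Q.hom) ▷₂ M.mul)) ≫ strictId ≫
    (((α_ U V X).hom ≫ (𝟙 U ⊗ₘ (β_ V X).hom) ≫ (α_ U X V).inv ≫ ((β_ U X).hom ⊗ₘ 𝟙 V) ≫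
      ((𝟙 X ⊗ₘ P.hom) ⊗ₘ Q.hom)) ◁₂ M.assoc.hom) ≫ strictId


/-- The 2-cell `γ` of the unit centre piece, with components `1 · x ≅ x ≅ x · 1`. -/
def unitCell (M : Pseudomonoid X) :
    (M.one ⊗ₘ 𝟙 X) ≫ M.mul ⟶ (β_ (𝟙_ B) X).hom ≫ (𝟙 X ⊗ₘ M.one) ≫ M.mul :=
  M.oneMul.hom ≫ strictId ≫ ((β_ (𝟙_ B) X).hom ◁₂ M.mulOne.inv)

end CentrePiece

/-- The braided pseudomonoid `N` on `Z` is a monoidal centre of the pseudomonoid `M`.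
The data consist of a centre piece `piece` with domain `Z` that represents `CP(-, M)`: for every `U`,
the functor `Hom(U, Z) ⥤ CP(U, M)`, `h ↦ h^* piece`, is an equivalence. The braided pseudomonoid
structure of `Z` is the one inherited from the tensor product of centre pieces: the underlying 1-cell
of `piece` is strong monoidal, its structure 2-cells are morphisms from the tensor product of
`piece` with itself, respectively the unit centre piece, to the restriction of `piece` along the
multiplication, respectively the unit (`mul_compat`, `one_compat`), and the braiding of `N` is
given by `γ` (`braiding_compat`). -/
structure MonoidalCentre {X Z : B} (M : Pseudomonoid X) (N : BraidedPseudomonoid Z) where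
  piece : CentrePiece M Z
  universal : ∀ U : B, (piece.restrictFunctor U).IsEquivalence
  strong : PseudomonoidHom N.toPseudomonoid M piece.hom
  mul_compat :
    ((strong.mulIso.hom ⊠₂ 𝟙 (𝟙 X)) ▷₂ M.mul) ≫ (piece.restrict N.mul).γ.hom =
      CentrePiece.tensorCell piece piece ≫
        ((β_ (Z ⊗ Z) X).hom ◁₂ ((𝟙 (𝟙 X) ⊠₂ strong.mulIso.hom) ▷₂ M.mul))
  one_compat :
    ((strong.oneIso.hom ⊠₂ 𝟙 (𝟙 X)) ▷₂ M.mul) ≫ (piece.restrict N.one).γ.hom =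
      CentrePiece.unitCell M ≫
        ((β_ (𝟙_ B) X).hom ◁₂ ((𝟙 (𝟙 X) ⊠₂ strong.oneIso.hom) ▷₂ M.mul))
  braiding_compat :
    strong.mulIso.hom ≫ (N.braiding.hom ▷₂ piece.hom) =
      strictId ≫
        ((𝟙 Z ⊗ₘ piece.hom) ◁₂ piece.γ.hom) ≫
        strictId ≫
        ((β_ Z Z).hom ◁₂ strong.mulIso.hom) ≫ strictId

end Restriction

namespace CatStar

open scoped CategoryTheory.Prod

/-- `Cat_*` is a symmetric monoidal 2-category under product. -/
instance symmetricMonoidalTwoCategory : SymmetricMonoidalTwoCategory CatStar.{v, u} where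
  tensor₂ η θ :=
    { nat := NatTrans.prod η.nat θ.nat
      w := Prod.ext η.w θ.w }
  tensor₂_id f g := by apply hom₂_ext; intro x; rfl
  tensor₂_comp η η' θ θ' := by apply hom₂_ext; intro x; rfl
  tensor₂_whiskerLeft h k _ _ _ _ η θ := by
    apply hom₂_ext; intro x
    simp only [comp_nat, NatTrans.comp_app, eqToHom_nat_app]
    simp; rfl
  tensor₂_whiskerRight η θ h k := by
    apply hom₂_ext; intro x
    simp only [comp_nat, NatTrans.comp_app, eqToHom_nat_app]
    simp; rfl
  associator_natural η θ κ := by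
    apply hom₂_ext; intro x
    simp only [comp_nat, NatTrans.comp_app, eqToHom_nat_app]
    exact ((Category.id_comp _).trans (Category.comp_id _)).symm
  leftUnitor_natural η := by
    apply hom₂_ext; intro x
    simp only [comp_nat, NatTrans.comp_app, eqToHom_nat_app]
    simp; rfl
  rightUnitor_natural η := by
    apply hom₂_ext; intro x
    simp only [comp_nat, NatTrans.comp_app, eqToHom_nat_app]
    simp; rfl
  braiding_natural η θ := by
    apply hom₂_ext; intro x
    simp only [comp_nat, NatTrans.comp_app, eqToHom_nat_app]
    simp; rfl



section OfMonoid

open MonObj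

variable {C : Type u} [Category.{v} C] [MonoidalCategory C]

/-- The object `(C, A)` of `Cat_*`. -/
abbrev of (A : C) : CatStar.{v, u} := { carrier := C, pt := A }

/-- The multiplication of `(C, A)`: the tensor product of `C`, with the multiplication of `A`. -/
@[simps]
def ofMul (A : C) [MonObj A] : of A ⊗ of A ⟶ of A where
  functor := MonoidalCategory.tensor C
  map := (μ : A ⊗ A ⟶ A)

/-- The unit of `(C, A)`: the unit object of `C`, with the unit of `A`. -/
@[simps]
def ofOne (A : C) [MonObj A] : 𝟙_ CatStar.{v, u} ⟶ of A where
  functor := (Functor.const _).obj (𝟙_ C)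
  map := (η : 𝟙_ C ⟶ A)

def ofAssoc (A : C) [MonObj A] :
    (ofMul A ⊗ₘ 𝟙 (of A)) ≫ ofMul A ≅
      (α_ (of A) (of A) (of A)).hom ≫ (𝟙 (of A) ⊗ₘ ofMul A) ≫ ofMul A :=
  mkIso (NatIso.ofComponents (fun x : (C × C) × C => α_ x.1.1 x.1.2 x.2)
      (fun f => associator_naturality _ _ _)) (by
    change (α_ A A A).hom ≫ (𝟙 A ⊗ₘ (𝟙 A ⊗ₘ 𝟙 A)) ≫ (𝟙 A ⊗ₘ μ[A]) ≫ μ[A] = (μ[A] ⊗ₘ 𝟙 A) ≫ μ[A]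
    simp)

def ofOneMul (A : C) [MonObj A] :
    (ofOne A ⊗ₘ 𝟙 (of A)) ≫ ofMul A ≅ (λ_ (of A)).hom :=
  mkIso (NatIso.ofComponents (fun x : Pt.{u} × C => λ_ x.2)
      (fun {x y} f => by
        change (𝟙 (𝟙_ C) ⊗ₘ f.2) ≫ (λ_ y.2).hom = (λ_ x.2).hom ≫ f.2
        simp)) (by
    change (λ_ A).hom ≫ 𝟙 A = (η[A] ⊗ₘ 𝟙 A) ≫ μ[A]
    simp)

def ofMulOne (A : C) [MonObj A] :
    (𝟙 (of A) ⊗ₘ ofOne A) ≫ ofMul A ≅ (ρ_ (of A)).hom :=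
  mkIso (NatIso.ofComponents (fun x : C × Pt.{u} => ρ_ x.1)
      (fun {x y} f => by
        change (f.1 ⊗ₘ 𝟙 (𝟙_ C)) ≫ (ρ_ y.1).hom = (ρ_ x.1).hom ≫ f.1
        simp)) (by
    change (ρ_ A).hom ≫ 𝟙 A = (𝟙 A ⊗ₘ η[A]) ≫ μ[A]
    simp)

/-- The pseudomonoid `(C, A)` in `Cat_*` given by a monoid `A` in a monoidal category `C`; its
constraints are those of `C`. -/
def pseudomonoid (A : C) [MonObj A] : Pseudomonoid (of A) where
  mul := ofMul A
  one := ofOne A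
  assoc := ofAssoc A
  oneMul := ofOneMul A
  mulOne := ofMulOne A
  pentagon := by
    apply hom₂_ext
    rintro ⟨⟨⟨a, b⟩, c⟩, d⟩
    simp only [comp_nat, NatTrans.comp_app, eqToHom_nat_app]
    refine Eq.trans (b := ((α_ a b c).hom ⊗ₘ 𝟙 d) ≫ 𝟙 _ ≫ (α_ a (b ⊗ c) d).hom ≫ 𝟙 _ ≫
      (𝟙 a ⊗ₘ (α_ b c d).hom)) rfl (Eq.trans (b := 𝟙 _ ≫ (α_ (a ⊗ b) c d).hom ≫ 𝟙 _ ≫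
        (α_ a b (c ⊗ d)).hom ≫ 𝟙 _) ?_ rfl)
    simp
  triangle := by
    apply hom₂_ext
    rintro ⟨⟨a, b⟩, c⟩
    simp only [comp_nat, NatTrans.comp_app, eqToHom_nat_app]
    refine Eq.trans (b := ((ρ_ a).hom ⊗ₘ 𝟙 c)) rfl (Eq.trans (b := 𝟙 _ ≫ (α_ a (𝟙_ C) c).hom ≫ 𝟙 _ ≫
        (𝟙 a ⊗ₘ (λ_ c).hom) ≫ 𝟙 _) ?_ rfl)
    simp


def ofBraiding [BraidedCategory C] (A : C) [MonObj A] [IsCommMonObj A] :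
    ofMul A ≅ (β_ (of A) (of A)).hom ≫ ofMul A :=
  mkIso (NatIso.ofComponents (fun x : C × C => β_ x.1 x.2)
      (fun {x y} f => by
        change (f.1 ⊗ₘ f.2) ≫ (β_ y.1 y.2).hom = (β_ x.1 x.2).hom ≫ (f.2 ⊗ₘ f.1)
        simp)) (by
    change (β_ A A).hom ≫ (𝟙 A ⊗ₘ 𝟙 A) ≫ μ[A] = μ[A]
    simp)

/-- The braided pseudomonoid `(C, A)` in `Cat_*` given by a commutative monoid `A` in a braided
monoidal category `C`; its braiding is that of `C`. -/
def braidedPseudomonoid [BraidedCategory C] (A : C) [MonObj A] [IsCommMonObj A] :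
    BraidedPseudomonoid (of A) where
  toPseudomonoid := pseudomonoid A
  braiding := ofBraiding A
  hexagon_forward := by
    apply hom₂_ext
    rintro ⟨⟨a, b⟩, c⟩
    simp only [comp_nat, NatTrans.comp_app, eqToHom_nat_app]
    refine Eq.trans (b := (α_ a b c).hom ≫ 𝟙 _ ≫ (β_ a (b ⊗ c)).hom ≫ 𝟙 _ ≫ (α_ b c a).hom) rfl
      (Eq.trans (b := ((β_ a b).hom ⊗ₘ 𝟙 c) ≫ 𝟙 _ ≫ (α_ b a c).hom ≫ 𝟙 _ ≫
        (𝟙 b ⊗ₘ (β_ a c).hom) ≫ 𝟙 _) ?_ rfl)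
    simp
  hexagon_reverse := by
    apply hom₂_ext
    rintro ⟨a, ⟨b, c⟩⟩
    simp only [comp_nat, NatTrans.comp_app, eqToHom_nat_app]
    refine Eq.trans (b := (α_ a b c).inv ≫ 𝟙 _ ≫ (β_ (a ⊗ b) c).hom ≫ 𝟙 _ ≫ (α_ c a b).inv) rfl
      (Eq.trans (b := 𝟙 _ ≫ (𝟙 a ⊗ₘ (β_ b c).hom) ≫ 𝟙 _ ≫ (α_ a c b).inv ≫ 𝟙 _ ≫
        ((β_ a c).hom ⊗ₘ 𝟙 b) ≫ 𝟙 _) ?_ rfl)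
    simp

end OfMonoid

end CatStar


section Davydov

open MonObj

/-- An object of Davydov's category of a monoid `A`: an object `Z` of the centre of `C`, and a
morphism `ζ : Z ⟶ A` in `C` with `(ζ ⊗ 1) ≫ μ = u_A ≫ (1 ⊗ ζ) ≫ μ`, where `u` is the half
braiding of `Z`. -/
structure DavydovObj {C : Type u} [Category.{v} C] [MonoidalCategory C] (A : C) [MonObj A] where
  obj : Center C
  ζ : obj.1 ⟶ A
  comm : (ζ ▷ A) ≫ μ[A] = (obj.2.β A).hom ≫ (A ◁ ζ) ≫ μ[A]

namespace DavydovObj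

variable {C : Type u} [Category.{v} C] [MonoidalCategory C] {A : C} [MonObj A]

/-- Morphisms are the morphisms in the centre of `C` over `A`. -/
@[ext]
structure Hom (x y : DavydovObj A) where
  hom : x.obj ⟶ y.obj
  w : hom.f ≫ y.ζ = x.ζ

instance : Category (DavydovObj A) where
  Hom x y := Hom x y
  id x := { hom := 𝟙 x.obj, w := by simp }
  comp f g := { hom := f.hom ≫ g.hom, w := by simp [f.w, g.w] }
  id_comp f := Hom.ext (Category.id_comp _)
  comp_id f := Hom.ext (Category.comp_id _)
  assoc f g h := Hom.ext (Category.assoc _ _ _)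

end DavydovObj

end Davydov

/-! Leave the chosen objects aside. A centre piece for `C` is then a functor `p` into `C` with
isomorphisms `p u ⊗ c ≅ c ⊗ p u`, natural in both variables and multiplicative in `c`; this is the
same as a functor into the Drinfeld centre (`liftFunctor`, `centrePiece`). The chosen objects add a
morphism `φ` from the value of `p` at the chosen object to `A`, and the demand that `γ` be a 2-cell
of `Cat_*` says exactly that `φ` satisfies Davydov's condition (`centrePieceIso_map`). A 1-cell into
the centre pointed by `z.obj` adds instead a morphism of the centre into `z.obj`. Terminality of `z`
exchanges the two kinds of data, which is the universal property `centrePiece_isEquivalence`: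
existence of maps to `z` gives essential surjectivity, and their uniqueness gives fullness.

The same two halves of terminality make `z.obj` a commutative monoid. Davydov's category contains
the unit `η` and is closed under `(ζ ⊗ ζ') ≫ μ` (`tensor_mul_whiskerRight_comm`), so the unit and
multiplication of `z.obj` are the unique maps over `A`. Every law holds after composition with
`z.ζ`, where it is a computation in `A`, and `hom_ext_of_isTerminal` lifts it to the centre.

The remaining compatibilities involve only identities, half-braidings and coherence isomorphisms;
they express how tensor, unit and braiding of the centre are defined. -/

open CategoryTheory MonoidalCategory

/-! ### Computations over a monoid, without half-braiding axioms. -/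

section MonoidHelpers

open MonObj

variable {C : Type u} [Category.{v} C] [MonoidalCategory C] {A : C} [MonObj A]

/-- In elements: `(xy)a = x(ya) = x(ay) = (xa)y = (ax)y = a(xy)`, moving `a` first past `g`, then
past `f`. For half-braidings `b` and `c` the long composite on the right is the half-braiding of the
tensor product. -/
theorem tensor_mul_whiskerRight_comm {X Y : C} {f : X ⟶ A} {g : Y ⟶ A}
    {b : X ⊗ A ⟶ A ⊗ X} {c : Y ⊗ A ⟶ A ⊗ Y}
    (hf : f ▷ A ≫ μ[A] = b ≫ A ◁ f ≫ μ[A]) (hg : g ▷ A ≫ μ[A] = c ≫ A ◁ g ≫ μ[A]) :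
    ((f ⊗ₘ g) ≫ μ[A]) ▷ A ≫ μ[A] =
      ((α_ X Y A).hom ≫ X ◁ c ≫ (α_ X A Y).inv ≫ b ▷ Y ≫ (α_ A X Y).hom) ≫
        A ◁ ((f ⊗ₘ g) ≫ μ[A]) ≫ μ[A] := by
  calc
    _ = (α_ _ _ _).hom ≫ X ◁ (g ▷ A ≫ μ[A]) ≫ f ▷ A ≫ μ[A] := by
      rw [MonoidalCategory.tensorHom_def']
      simp only [comp_whiskerRight, whiskerLeft_comp, Category.assoc, MonObj.mul_assoc,
        whisker_assoc, associator_naturality_left_assoc, Iso.inv_hom_id_assoc,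
        ← whisker_exchange_assoc]
    _ = (α_ _ _ _).hom ≫ X ◁ c ≫ (α_ _ _ _).inv ≫ (f ▷ A ≫ μ[A]) ▷ Y ≫ A ◁ g ≫ μ[A] := by
      rw [hg]
      simp only [whiskerLeft_comp, Category.assoc, comp_whiskerRight, ← whisker_exchange_assoc μ[A] g,
        whisker_exchange_assoc f μ[A], whisker_exchange_assoc f (A ◁ g),
        MonObj.mul_assoc, tensor_whiskerLeft]
      simp only [whiskerRight_tensor, Category.assoc, Iso.inv_hom_id_assoc]
    _ = _ := by
      rw [hf, MonoidalCategory.tensorHom_def]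
      simp only [whiskerLeft_comp, Category.assoc, comp_whiskerRight, ← whisker_exchange_assoc μ[A] g,
        MonObj.mul_assoc, tensor_whiskerLeft, whiskerRight_tensor, whisker_assoc,
        Iso.inv_hom_id_assoc, Iso.hom_inv_id_assoc]

/-- This and the next two lemmas transport the monoid laws of `A` to `X`, but only after composition
with `f`. For a full centre that is enough, since maps into it are detected over `A`. -/
theorem one_mul_over {X : C} {f : X ⟶ A} {e : 𝟙_ C ⟶ X} {m : X ⊗ X ⟶ X}
    (he : e ≫ f = η[A]) (hm : m ≫ f = (f ⊗ₘ f) ≫ μ[A]) :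
    (e ▷ X ≫ m) ≫ f = (λ_ X).hom ≫ f := by
  rw [Category.assoc, hm, MonoidalCategory.tensorHom_def, Category.assoc,
    ← comp_whiskerRight_assoc, he, ← whisker_exchange_assoc, MonObj.one_mul]
  simp

theorem mul_one_over {X : C} {f : X ⟶ A} {e : 𝟙_ C ⟶ X} {m : X ⊗ X ⟶ X}
    (he : e ≫ f = η[A]) (hm : m ≫ f = (f ⊗ₘ f) ≫ μ[A]) :
    (X ◁ e ≫ m) ≫ f = (ρ_ X).hom ≫ f := by
  rw [Category.assoc, hm, MonoidalCategory.tensorHom_def', Category.assoc,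
    ← MonoidalCategory.whiskerLeft_comp_assoc, he, whisker_exchange_assoc, MonObj.mul_one]
  simp

theorem mul_assoc_over {X : C} {f : X ⟶ A} {m : X ⊗ X ⟶ X}
    (hm : m ≫ f = (f ⊗ₘ f) ≫ μ[A]) :
    (m ▷ X ≫ m) ≫ f = ((α_ X X X).hom ≫ X ◁ m ≫ m) ≫ f := by
  simp only [Category.assoc, hm]
  rw [← tensorHom_id, ← id_tensorHom, tensorHom_comp_tensorHom_assoc,
    tensorHom_comp_tensorHom_assoc, hm, Category.id_comp]
  calc
    _ = ((f ⊗ₘ f) ⊗ₘ f) ≫ μ[A] ▷ A ≫ μ[A] := by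
      rw [← tensorHom_id, tensorHom_comp_tensorHom_assoc, Category.comp_id]
    _ = _ := by
      rw [MonObj.mul_assoc, associator_naturality_assoc, ← id_tensorHom,
        tensorHom_comp_tensorHom_assoc, Category.comp_id]

/-- Naturality `hbc` trades the braiding `b` of `X` with itself for the half-braiding `c` with `A`,
and centrality `hf` then absorbs `c` into the multiplication. `A` itself need not be commutative. -/
theorem mul_comm_over {X : C} {f : X ⟶ A} {m : X ⊗ X ⟶ X} {b : X ⊗ X ⟶ X ⊗ X}
    {c : X ⊗ A ⟶ A ⊗ X} (hbc : X ◁ f ≫ c = b ≫ f ▷ X) (hf : f ▷ A ≫ μ[A] = c ≫ A ◁ f ≫ μ[A])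
    (hm : m ≫ f = (f ⊗ₘ f) ≫ μ[A]) :
    (b ≫ m) ≫ f = m ≫ f := by
  rw [Category.assoc, hm, MonoidalCategory.tensorHom_def, Category.assoc, ← reassoc_of% hbc, ← hf,
    whisker_exchange_assoc]

end MonoidHelpers

/-! ### The commutative monoid structure on a full centre. -/

namespace DavydovObj

open MonObj

variable {C : Type u} [Category.{v} C] [MonoidalCategory C] {A : C} [MonObj A]

/-- Precomposition of an object of Davydov's category with a morphism of the centre. -/
def precomp (z : DavydovObj A) {W : Center C} (f : W ⟶ z.obj) : DavydovObj A where
  obj := W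
  ζ := f.f ≫ z.ζ
  comm := by
    have h := f.comm_assoc A (A ◁ z.ζ ≫ μ[A])
    rw [comp_whiskerRight, Category.assoc, z.comm, h, MonoidalCategory.whiskerLeft_comp,
      Category.assoc]

/-- Equal composites with `z.ζ` turn `f` and `g` into maps to `z` from one and the same object of
Davydov's category, so they coincide. This lifts identities over `A` to identities in the centre. -/
theorem hom_ext_of_isTerminal {z : DavydovObj A} (hz : Limits.IsTerminal z) {W : Center C}
    {f g : W ⟶ z.obj} (h : f.f ≫ z.ζ = g.f ≫ z.ζ) : f = g :=
  congrArg Hom.hom (Limits.IsTerminal.hom_ext hz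
    (show z.precomp g ⟶ z from ⟨f, h⟩) (show z.precomp g ⟶ z from ⟨g, rfl⟩))

/-- The unit object of Davydov's category. -/
noncomputable def unit (A : C) [MonObj A] : DavydovObj A where
  obj := 𝟙_ (Center C)
  ζ := η[A]
  comm := by
    -- The half-braiding of the unit object of the centre is `λ ≫ ρ⁻¹`.
    change η[A] ▷ A ≫ μ[A] = ((λ_ A).hom ≫ (ρ_ A).inv) ≫ A ◁ η[A] ≫ μ[A]
    simp

/-- The tensor product of objects of Davydov's category. -/
noncomputable def tensor (x y : DavydovObj A) : DavydovObj A where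
  obj := x.obj ⊗ y.obj
  ζ := (x.ζ ⊗ₘ y.ζ) ≫ μ[A]
  comm := tensor_mul_whiskerRight_comm x.comm y.comm

variable {z : DavydovObj A}

/-- The monoid structure on a full centre. -/
@[reducible]
noncomputable def monObj (hz : Limits.IsTerminal z) : MonObj z.obj where
  one := (hz.from (unit A)).hom
  mul := (hz.from (z.tensor z)).hom
  one_mul := hom_ext_of_isTerminal hz
    (one_mul_over (hz.from (unit A)).w (hz.from (z.tensor z)).w)
  mul_one := hom_ext_of_isTerminal hz
    (mul_one_over (hz.from (unit A)).w (hz.from (z.tensor z)).w)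
  mul_assoc := hom_ext_of_isTerminal hz (mul_assoc_over (hz.from (z.tensor z)).w)

theorem isCommMonObj (hz : Limits.IsTerminal z) :
    letI := monObj hz
    IsCommMonObj z.obj :=
  letI := monObj hz
  ⟨hom_ext_of_isTerminal hz
    -- The braiding of `z.obj` with itself is its half-braiding at its own underlying object, so
    -- naturality along `z.ζ` relates it to the half-braiding at `A`.
    (mul_comm_over (z.obj.2.naturality z.ζ) z.comm (hz.from (z.tensor z)).w)⟩

end DavydovObj

/-! ### Centre pieces for `(C, A)` in components. -/

namespace CatStar

open scoped CategoryTheory.Prod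
open MonObj

section Components

variable {C : Type u} [Category.{v} C] [MonoidalCategory C] {A : C} [MonObj A]
  {U V : CatStar.{v, u}}

/-- The components of the invertible 2-cell of a centre piece for `(C, A)`. -/
def centrePieceIso (P : CentrePiece (pseudomonoid A) U) (x : U.carrier) (c : C) :
    P.hom.functor.obj x ⊗ c ≅ c ⊗ P.hom.functor.obj x where
  hom := P.γ.hom.nat.app (x, c)
  inv := P.γ.inv.nat.app (x, c)
  hom_inv_id := congrArg (fun t => Hom₂.nat t |>.app (x, c)) P.γ.hom_inv_id
  inv_hom_id := congrArg (fun t => Hom₂.nat t |>.app (x, c)) P.γ.inv_hom_id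

theorem centrePieceIso_naturality_right (P : CentrePiece (pseudomonoid A) U) (x : U.carrier)
    {c d : C} (f : c ⟶ d) :
    P.hom.functor.obj x ◁ f ≫ (centrePieceIso P x d).hom =
      (centrePieceIso P x c).hom ≫ f ▷ P.hom.functor.obj x := by
  have h : (P.hom.functor.map (𝟙 x) ⊗ₘ f) ≫ (centrePieceIso P x d).hom =
      (centrePieceIso P x c).hom ≫ (f ⊗ₘ P.hom.functor.map (𝟙 x)) :=
    P.γ.hom.nat.naturality (X := (x, c)) (Y := (x, d)) (𝟙 x ×ₘ f)
  have e : P.hom.functor.map (𝟙 x) = 𝟙 (P.hom.functor.obj x) := P.hom.functor.map_id x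
  rw [e] at h
  rw [← id_tensorHom, ← tensorHom_id]
  exact h

theorem centrePieceIso_naturality_left (P : CentrePiece (pseudomonoid A) U) {x y : U.carrier}
    (f : x ⟶ y) (c : C) :
    P.hom.functor.map f ▷ c ≫ (centrePieceIso P y c).hom =
      (centrePieceIso P x c).hom ≫ c ◁ P.hom.functor.map f := by
  have h : (P.hom.functor.map f ⊗ₘ 𝟙 c) ≫ (centrePieceIso P y c).hom =
      (centrePieceIso P x c).hom ≫ (𝟙 c ⊗ₘ P.hom.functor.map f) :=
    P.γ.hom.nat.naturality (X := (x, c)) (Y := (y, c)) (f ×ₘ 𝟙 c)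
  simpa only [id_tensorHom, tensorHom_id] using h

/-- The cocycle condition at `((x, c), d)`, solved for `γ` at `c ⊗ d`, is the multiplicativity axiom
of a half-braiding. -/
theorem centrePieceIso_tensor (P : CentrePiece (pseudomonoid A) U) (x : U.carrier) (c d : C) :
    (centrePieceIso P x (c ⊗ d)).hom =
      (α_ _ _ _).inv ≫ (centrePieceIso P x c).hom ▷ d ≫ (α_ _ _ _).hom ≫
        c ◁ (centrePieceIso P x d).hom ≫ (α_ _ _ _).inv := by
  have h := congrArg (fun t => Hom₂.nat t |>.app ((x, c), d)) P.cocycle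
  simp only [comp_nat, NatTrans.comp_app, eqToHom_nat_app] at h
  -- The equalities of 1-cells behind `strictId` hold definitionally on objects, so their components
  -- are identities and the pasting becomes an equation in `C`. The `Eq.trans … rfl` steps further
  -- on use the same unfolding.
  have h' : ((centrePieceIso P x c).hom ⊗ₘ 𝟙 d) ≫ 𝟙 _ ≫ (α_ _ _ _).hom ≫ 𝟙 _ ≫
      (𝟙 c ⊗ₘ (centrePieceIso P x d).hom) = 𝟙 _ ≫ (α_ _ _ _).hom ≫ 𝟙 _ ≫
        (centrePieceIso P x (c ⊗ d)).hom ≫ 𝟙 _ ≫ (α_ _ _ _).hom ≫ 𝟙 _ := h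
  simp only [Category.id_comp, Category.comp_id, tensorHom_id, id_tensorHom] at h'
  rw [reassoc_of% h']
  simp

/-- This is the compatibility of the 2-cell `γ` with the chosen objects, that is, Davydov's
condition for `P.hom.map`. -/
theorem centrePieceIso_map (P : CentrePiece (pseudomonoid A) U) :
    P.hom.map ▷ A ≫ μ[A] = (centrePieceIso P U.pt A).hom ≫ A ◁ P.hom.map ≫ μ[A] := by
  have h : (centrePieceIso P U.pt A).hom ≫ (𝟙 A ⊗ₘ P.hom.functor.map (𝟙 U.pt)) ≫
      (𝟙 A ⊗ₘ P.hom.map) ≫ μ[A] = (P.hom.map ⊗ₘ 𝟙 A) ≫ μ[A] := P.γ.hom.w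
  simpa using h.symm

/-- The restricted 2-cell is a whiskering of `γ` conjugated by equalities of 1-cells, whose
components are identities. -/
theorem restrict_centrePieceIso_hom (P : CentrePiece (pseudomonoid A) U) (h : V ⟶ U)
    (x : V.carrier) (c : C) :
    (centrePieceIso (P.restrict h) x c).hom = (centrePieceIso P (h.functor.obj x) c).hom := by
  change (P.restrictγ h).hom.nat.app (x, c) = _
  simp only [CentrePiece.restrictγ, Iso.trans_hom, eqToIso.hom, comp_nat, NatTrans.comp_app,
    eqToHom_nat_app]
  exact (Category.id_comp _).trans (Category.comp_id _)

theorem centrePieceHom_comm {P Q : CentrePiece (pseudomonoid A) U} (f : P ⟶ Q)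
    (x : U.carrier) (c : C) :
    f.cell.nat.app x ▷ c ≫ (centrePieceIso Q x c).hom =
      (centrePieceIso P x c).hom ≫ c ◁ f.cell.nat.app x := by
  have h : (f.cell.nat.app x ⊗ₘ 𝟙 c) ≫ (centrePieceIso Q x c).hom =
      (centrePieceIso P x c).hom ≫ (𝟙 c ⊗ₘ f.cell.nat.app x) :=
    congrArg (fun t => Hom₂.nat t |>.app (x, c)) f.comm
  simpa only [id_tensorHom, tensorHom_id] using h

/-- An isomorphism of centre pieces from an invertible 2-cell which commutes with the components
of the centre pieces. -/
def centrePieceIsoMk {P Q : CentrePiece (pseudomonoid A) U} (e : P.hom ≅ Q.hom)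
    (comm : ∀ x c, e.hom.nat.app x ▷ c ≫ (centrePieceIso Q x c).hom =
      (centrePieceIso P x c).hom ≫ c ◁ e.hom.nat.app x) : P ≅ Q where
  hom :=
    { cell := e.hom
      comm := by
        apply hom₂_ext
        rintro ⟨x, c⟩
        have h := comm x c
        rw [← tensorHom_id, ← id_tensorHom] at h
        exact h }
  inv :=
    { cell := e.inv
      comm := by
        apply hom₂_ext
        rintro ⟨x, c⟩
        have h := comm x c
        have e₁ : e.hom.nat.app x ≫ e.inv.nat.app x = 𝟙 _ :=
          congrArg (fun t => Hom₂.nat t |>.app x) e.hom_inv_id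
        have e₂ : e.inv.nat.app x ≫ e.hom.nat.app x = 𝟙 _ :=
          congrArg (fun t => Hom₂.nat t |>.app x) e.inv_hom_id
        have h' : e.inv.nat.app x ▷ c ≫ (centrePieceIso P x c).hom =
            (centrePieceIso Q x c).hom ≫ c ◁ e.inv.nat.app x := by
          -- Multiply `h` by the inverse components on both sides.
          calc
            _ = e.inv.nat.app x ▷ c ≫ (centrePieceIso P x c).hom ≫
                c ◁ (e.hom.nat.app x ≫ e.inv.nat.app x) := by rw [e₁]; simp
            _ = (e.inv.nat.app x ≫ e.hom.nat.app x) ▷ c ≫ (centrePieceIso Q x c).hom ≫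
                c ◁ e.inv.nat.app x := by
              rw [MonoidalCategory.whiskerLeft_comp, ← reassoc_of% h, comp_whiskerRight,
                Category.assoc]
            _ = _ := by rw [e₂]; simp
        rw [← tensorHom_id, ← id_tensorHom] at h'
        exact h' }
  hom_inv_id := CentrePiece.Hom.ext e.hom_inv_id
  inv_hom_id := CentrePiece.Hom.ext e.inv_hom_id

end Components

end CatStar

/-- Normalization at the unit is not an axiom of a half-braiding but follows: multiplicativity at `𝟙
⊗ 𝟙` with naturality along `λ_ 𝟙` gives the identity tensored with `𝟙` and followed by the
invertible `b.β 𝟙`, and both can be cancelled. -/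
theorem CategoryTheory.HalfBraiding.β_unit_hom {C : Type u} [Category.{v} C] [MonoidalCategory C]
    {X : C} (b : HalfBraiding X) : (b.β (𝟙_ C)).hom ≫ (λ_ X).hom = (ρ_ X).hom := by
  have h := b.naturality (λ_ (𝟙_ C)).hom
  rw [b.monoidal] at h
  have h' : (α_ X (𝟙_ C) (𝟙_ C)).inv ≫ ((b.β (𝟙_ C)).hom ≫ (λ_ X).hom) ▷ 𝟙_ C =
      (α_ X (𝟙_ C) (𝟙_ C)).inv ≫ (ρ_ X).hom ▷ 𝟙_ C := by
    rw [← cancel_mono (b.β (𝟙_ C)).hom]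
    rw [triangle_assoc_comp_right, Category.assoc, h]
    simp only [Category.assoc, comp_whiskerRight,
      MonoidalCategory.leftUnitor_naturality, leftUnitor_whiskerRight, Iso.inv_hom_id_assoc]
  rwa [cancel_epi, whiskerRight_iff] at h'

/-! ### The universal property of the forgetful centre piece. -/

namespace CatStar

open scoped CategoryTheory.Prod

section FullCentre

-- An object of the centre carries a family of morphisms indexed by `C`, so `Center C` lives in `max
-- u v`; with `C` there too, both are carriers of objects of one `CatStar`.
variable {C : Type (max u v)} [Category.{v} C] [MonoidalCategory C] {A : C} [MonObj A]

/-- The 2-cell of half-braidings on the forgetful functor of the centre. -/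
def halfBraidingCell (z : DavydovObj A) :
    ((show of z.obj ⟶ of A from { functor := Center.forget C, map := z.ζ }) ⊗ₘ 𝟙 (of A)) ≫
        ofMul A ≅
      (β_ (of z.obj) (of A)).hom ≫
        (𝟙 (of A) ⊗ₘ (show of z.obj ⟶ of A from { functor := Center.forget C, map := z.ζ })) ≫
        ofMul A :=
  mkIso (NatIso.ofComponents (fun x : Center C × C => x.1.2.β x.2) (fun {x y} f => by
      change (f.1.f ⊗ₘ f.2) ≫ (y.1.2.β y.2).hom = (x.1.2.β x.2).hom ≫ (f.2 ⊗ₘ f.1.f)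
      rw [MonoidalCategory.tensorHom_def, MonoidalCategory.tensorHom_def', Category.assoc,
        y.1.2.naturality, f.1.comm_assoc])) (by
    -- Compatibility with the chosen objects is Davydov's condition on `z.ζ`.
    change (z.obj.2.β A).hom ≫ (𝟙 A ⊗ₘ 𝟙 z.obj.1) ≫ (𝟙 A ⊗ₘ z.ζ) ≫ MonObj.mul = (z.ζ ⊗ₘ 𝟙 A) ≫ MonObj.mul
    simpa using z.comm.symm)

/-- The centre piece for `(C, A)` given by the forgetful functor of the centre, a morphism
`z.obj ⟶ A` in Davydov's category and the half-braidings. -/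
def centrePiece (z : DavydovObj A) : CentrePiece (pseudomonoid A) (of z.obj) where
  hom := { functor := Center.forget C, map := z.ζ }
  γ := halfBraidingCell z
  cocycle := by
    apply hom₂_ext
    rintro ⟨⟨x, c⟩, d⟩
    simp only [comp_nat, NatTrans.comp_app, eqToHom_nat_app]
    refine Eq.trans (b := ((x.2.β c).hom ⊗ₘ 𝟙 d) ≫ 𝟙 _ ≫ (α_ _ _ _).hom ≫ 𝟙 _ ≫
      (𝟙 c ⊗ₘ (x.2.β d).hom)) rfl (Eq.trans (b := 𝟙 _ ≫ (α_ _ _ _).hom ≫ 𝟙 _ ≫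
        (x.2.β (c ⊗ d)).hom ≫ 𝟙 _ ≫ (α_ _ _ _).hom ≫ 𝟙 _) ?_ rfl)
    simp
  unit := by
    apply hom₂_ext
    rintro ⟨x, -⟩
    simp only [comp_nat, NatTrans.comp_app, eqToHom_nat_app]
    refine Eq.trans (b := (x.2.β (𝟙_ C)).hom ≫ 𝟙 _ ≫ (λ_ x.1).hom) rfl
      (Eq.trans (b := 𝟙 _ ≫ (ρ_ x.1).hom ≫ 𝟙 _) ?_ rfl)
    simp only [Category.id_comp, Category.comp_id, HalfBraiding.β_unit_hom]

/-- The functor to the centre of `C` classifying a centre piece for `(C, A)`. -/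
def liftFunctor {U : CatStar.{v, max u v}} (P : CentrePiece (pseudomonoid A) U) :
    U.carrier ⥤ Center C where
  obj x := ⟨P.hom.functor.obj x,
    { β := centrePieceIso P x
      monoidal := centrePieceIso_tensor P x
      naturality := centrePieceIso_naturality_right P x }⟩
  map f := ⟨P.hom.functor.map f, centrePieceIso_naturality_left P f⟩
  map_id x := Center.ext _ _ (P.hom.functor.map_id x)
  map_comp f g := Center.ext _ _ (P.hom.functor.map_comp f g)

/-- The object of Davydov's category underlying a centre piece for `(C, A)`. -/
def davydovObj {U : CatStar.{v, max u v}} (P : CentrePiece (pseudomonoid A) U) :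
    DavydovObj A where
  obj := (liftFunctor P).obj U.pt
  ζ := P.hom.map
  comm := centrePieceIso_map P

variable {z : DavydovObj A}

/-- On functors this is the dictionary between centre pieces and functors to the centre; terminality
of `z` is needed only for the chosen objects. -/
theorem centrePiece_isEquivalence (hz : Limits.IsTerminal z) (U : CatStar.{v, max u v}) :
    ((centrePiece z).restrictFunctor U).IsEquivalence where
  faithful := ⟨fun {h k} σ τ e => by
    apply hom₂_ext
    intro x
    exact Center.ext _ _ (congrArg (fun t => (Hom₂.nat (CentrePiece.Hom.cell t)).app x) e)⟩
  full := ⟨fun {h k} f => by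
    -- Commuting with `γ` says that each component of `f` is a morphism of the centre.
    have comm (x : U.carrier) (c : C) : f.cell.nat.app x ▷ c ≫ ((k.functor.obj x).2.β c).hom =
        ((h.functor.obj x).2.β c).hom ≫ c ◁ f.cell.nat.app x :=
      ((congrArg (fun t => _ ≫ t) (restrict_centrePieceIso_hom (centrePiece z) k x c)).symm.trans
        (centrePieceHom_comm f x c)).trans
        (congrArg (fun t => t ≫ _) (restrict_centrePieceIso_hom (centrePiece z) h x c))
    refine ⟨{ nat := { app := fun x => ⟨f.cell.nat.app x, comm x⟩, naturality := ?_ }, w := ?_ }, ?_⟩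
    · intro x y g
      exact Center.ext _ _ (f.cell.nat.naturality g)
    -- A 2-cell into the centre needs an equation between maps to `z.obj`, whereas `f` provides it
    -- only over `A`; uniqueness closes the gap.
    · refine DavydovObj.hom_ext_of_isTerminal hz ?_
      exact (Category.assoc _ _ _).trans f.cell.w
    · rfl⟩
  essSurj := ⟨fun P => by
    -- The lift sends the chosen object to an object of Davydov's category via `P.hom.map`, and its
    -- structure map is the unique map to `z`. Restriction along it returns `P` up to identity
    -- components.
    let h : U ⟶ of z.obj :=
      { functor := liftFunctor P
        map := (hz.from (davydovObj P)).hom }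
    refine ⟨h, ⟨centrePieceIsoMk (mkIso (Iso.refl _) ?_) ?_⟩⟩
    · exact (Category.id_comp _).trans (hz.from (davydovObj P)).w.symm
    · intro x c
      refine Eq.trans ?_ (congrArg (fun t => t ≫ c ◁ 𝟙 (P.hom.functor.obj x))
        (restrict_centrePieceIso_hom (centrePiece z) h x c)).symm
      change 𝟙 (P.hom.functor.obj x) ▷ c ≫ (centrePieceIso P x c).hom =
        (centrePieceIso P x c).hom ≫ c ◁ 𝟙 (P.hom.functor.obj x)
      rw [id_whiskerRight, MonoidalCategory.whiskerLeft_id, Category.id_comp, Category.comp_id]⟩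

end FullCentre

end CatStar

/-! ### The braided pseudomonoid structure and its compatibilities. -/

namespace CatStar

open scoped CategoryTheory.Prod

section MonoidalCentre

variable {C : Type (max u v)} [Category.{v} C] [MonoidalCategory C] {A : C} [MonObj A]

/-- The projection of a commutative monoid of the centre, over a monoid morphism to `A`, is strong
monoidal with identity constraints. -/
noncomputable def forgetPseudomonoidHom (z : DavydovObj A) [MonObj z.obj] [IsCommMonObj z.obj]
    (hone : (MonObj.one : 𝟙_ (Center C) ⟶ z.obj).f ≫ z.ζ = MonObj.one)
    (hmul : (MonObj.mul : z.obj ⊗ z.obj ⟶ z.obj).f ≫ z.ζ = (z.ζ ⊗ₘ z.ζ) ≫ MonObj.mul) :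
    PseudomonoidHom (braidedPseudomonoid z.obj).toPseudomonoid (pseudomonoid A)
      (centrePiece z).hom where
  -- Identity components respect the chosen objects precisely because `z.ζ` is multiplicative; for
  -- `oneIso`, because it is unital.
  mulIso := mkIso (NatIso.ofComponents (fun x : Center C × Center C => Iso.refl (x.1.1 ⊗ x.2.1))
    (fun {x y} f => by
      change (f.1.f ⊗ₘ f.2.f) ≫ 𝟙 (y.1.1 ⊗ y.2.1) = 𝟙 (x.1.1 ⊗ x.2.1) ≫ (f.1.f ⊗ₘ f.2.f)
      rw [Category.comp_id, Category.id_comp])) ((Category.id_comp _).trans hmul)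
  oneIso := mkIso (NatIso.ofComponents (fun _ : Pt.{max u v} => Iso.refl (𝟙_ C))
    (fun {x y} f => rfl)) ((Category.id_comp _).trans hone)
  associativity := by
    apply hom₂_ext
    rintro ⟨⟨x, y⟩, t⟩
    simp only [comp_nat, NatTrans.comp_app, eqToHom_nat_app]
    refine Eq.trans (b := (𝟙 (x.1 ⊗ y.1) ⊗ₘ 𝟙 t.1) ≫ 𝟙 _ ≫ 𝟙 _ ≫ 𝟙 _ ≫ (α_ x.1 y.1 t.1).hom) rfl
      (Eq.trans (b := 𝟙 _ ≫ (α_ x.1 y.1 t.1).hom ≫ 𝟙 _ ≫ (𝟙 x.1 ⊗ₘ 𝟙 (y.1 ⊗ t.1)) ≫ 𝟙 _ ≫ 𝟙 _ ≫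
        𝟙 _) ?_ rfl)
    simp
  left_unitality := by
    apply hom₂_ext
    rintro ⟨-, x⟩
    simp only [comp_nat, NatTrans.comp_app, eqToHom_nat_app]
    refine Eq.trans (b := (𝟙 (𝟙_ C) ⊗ₘ 𝟙 x.1) ≫ 𝟙 _ ≫ 𝟙 _ ≫ 𝟙 _ ≫ (λ_ x.1).hom) rfl
      (Eq.trans (b := 𝟙 _ ≫ (λ_ x.1).hom ≫ 𝟙 _) ?_ rfl)
    simp
  right_unitality := by
    apply hom₂_ext
    rintro ⟨x, -⟩
    simp only [comp_nat, NatTrans.comp_app, eqToHom_nat_app]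
    refine Eq.trans (b := (𝟙 x.1 ⊗ₘ 𝟙 (𝟙_ C)) ≫ 𝟙 _ ≫ 𝟙 _ ≫ 𝟙 _ ≫ (ρ_ x.1).hom) rfl
      (Eq.trans (b := 𝟙 _ ≫ (ρ_ x.1).hom ≫ 𝟙 _) ?_ rfl)
    simp

/-- The centre of `C` with a full centre of `A` is a monoidal centre of `(C, A)`. -/
noncomputable def monoidalCentre {z : DavydovObj A} (hz : Limits.IsTerminal z)
    [MonObj z.obj] [IsCommMonObj z.obj]
    (hone : (MonObj.one : 𝟙_ (Center C) ⟶ z.obj).f ≫ z.ζ = MonObj.one)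
    (hmul : (MonObj.mul : z.obj ⊗ z.obj ⟶ z.obj).f ≫ z.ζ = (z.ζ ⊗ₘ z.ζ) ≫ MonObj.mul) :
    MonoidalCentre (pseudomonoid A) (braidedPseudomonoid z.obj) where
  piece := centrePiece z
  universal := centrePiece_isEquivalence hz
  strong := forgetPseudomonoidHom z hone hmul
  mul_compat := by
    apply hom₂_ext
    rintro ⟨⟨x, y⟩, c⟩
    simp only [comp_nat, NatTrans.comp_app, eqToHom_nat_app, CentrePiece.tensorCell]
    have e := restrict_centrePieceIso_hom (centrePiece z) (braidedPseudomonoid z.obj).mul (x, y) c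
    refine Eq.trans (b := (𝟙 (x.1 ⊗ y.1) ⊗ₘ 𝟙 c) ≫
      (centrePieceIso ((centrePiece z).restrict (braidedPseudomonoid z.obj).mul) (x, y) c).hom) rfl
      (Eq.trans (congrArg (fun t => (𝟙 (x.1 ⊗ y.1) ⊗ₘ 𝟙 c) ≫ t) e) ?_)
    -- The half-braiding of `x ⊗ y` in the centre unfolds to the composite that defines
    -- `tensorCell`.
    refine Eq.trans (b := (𝟙 (x.1 ⊗ y.1) ⊗ₘ 𝟙 c) ≫ (α_ x.1 y.1 c).hom ≫ x.1 ◁ (y.2.β c).hom ≫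
      (α_ x.1 c y.1).inv ≫ (x.2.β c).hom ▷ y.1 ≫ (α_ c x.1 y.1).hom) rfl
      (Eq.trans (b := (𝟙 _ ≫ (α_ x.1 y.1 c).hom ≫ 𝟙 _ ≫ (𝟙 x.1 ⊗ₘ (y.2.β c).hom) ≫ 𝟙 _ ≫
        (α_ x.1 c y.1).inv ≫ 𝟙 _ ≫ ((x.2.β c).hom ⊗ₘ 𝟙 y.1) ≫ 𝟙 _ ≫ (α_ c x.1 y.1).hom ≫ 𝟙 _) ≫
        (𝟙 c ⊗ₘ 𝟙 (x.1 ⊗ y.1))) ?_ rfl)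
    simp
  one_compat := by
    apply hom₂_ext
    rintro ⟨p, c⟩
    simp only [comp_nat, NatTrans.comp_app, eqToHom_nat_app, CentrePiece.unitCell]
    have e := restrict_centrePieceIso_hom (centrePiece z) (braidedPseudomonoid z.obj).one p c
    refine Eq.trans (b := (𝟙 (𝟙_ C) ⊗ₘ 𝟙 c) ≫
      (centrePieceIso ((centrePiece z).restrict (braidedPseudomonoid z.obj).one) p c).hom) rfl
      (Eq.trans (congrArg (fun t => (𝟙 (𝟙_ C) ⊗ₘ 𝟙 c) ≫ t) e) ?_)
    refine Eq.trans (b := (𝟙 (𝟙_ C) ⊗ₘ 𝟙 c) ≫ (λ_ c).hom ≫ (ρ_ c).inv) rfl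
      (Eq.trans (b := ((λ_ c).hom ≫ 𝟙 _ ≫ (ρ_ c).inv) ≫ (𝟙 c ⊗ₘ 𝟙 (𝟙_ C))) ?_ rfl)
    simp
  braiding_compat := by
    apply hom₂_ext
    rintro ⟨x, y⟩
    simp only [comp_nat, NatTrans.comp_app, eqToHom_nat_app]
    -- The braiding of the centre is by definition the half-braiding of its first argument.
    refine Eq.trans (b := 𝟙 _ ≫ (x.2.β y.1).hom) rfl
      (Eq.trans (b := 𝟙 _ ≫ (x.2.β y.1).hom ≫ 𝟙 _ ≫ 𝟙 _ ≫ 𝟙 _) ?_ rfl)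
    simp

end MonoidalCentre

end CatStar

/-- The component formulas are heterogeneous equalities because their types depend on `K.piece.hom`,
which the first clause identifies only propositionally. -/
theorem mainTheorem5 {C : Type (max u v)} [Category.{v} C] [MonoidalCategory C]
    (A : C) [MonObj A] (z : DavydovObj A) (hz : Limits.IsTerminal z) :
    ∃ (_ : MonObj z.obj) (_ : IsCommMonObj z.obj),
      ((MonObj.one : 𝟙_ (Center C) ⟶ z.obj).f ≫ z.ζ = MonObj.one ∧
        (MonObj.mul : z.obj ⊗ z.obj ⟶ z.obj).f ≫ z.ζ = (z.ζ ⊗ₘ z.ζ) ≫ MonObj.mul) ∧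
      ∃ K : MonoidalCentre (CatStar.pseudomonoid A) (CatStar.braidedPseudomonoid z.obj),
        K.piece.hom = { functor := Center.forget C, map := z.ζ } ∧
        (∀ (x : Center C) (c : C), K.piece.γ.hom.nat.app (x, c) ≍ (x.2.β c).hom) ∧
        (∀ x y : Center C, K.strong.mulIso.hom.nat.app (x, y) ≍ 𝟙 (x.1 ⊗ y.1)) ∧
        K.strong.oneIso.hom.nat.app CatStar.Pt.star ≍ 𝟙 (𝟙_ C) := by
  letI := DavydovObj.monObj hz
  haveI := DavydovObj.isCommMonObj hz
  have hone : (MonObj.one : 𝟙_ (Center C) ⟶ z.obj).f ≫ z.ζ = MonObj.one :=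
    (hz.from (DavydovObj.unit A)).w
  have hmul : (MonObj.mul : z.obj ⊗ z.obj ⟶ z.obj).f ≫ z.ζ = (z.ζ ⊗ₘ z.ζ) ≫ MonObj.mul :=
    (hz.from (z.tensor z)).w
  exact ⟨inferInstance, inferInstance, ⟨hone, hmul⟩, CatStar.monoidalCentre hz hone hmul, rfl,
    fun _ _ => HEq.rfl, fun _ _ => HEq.rfl, HEq.rfl⟩
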